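/- Let $\mathcal X$ and $\bar{\mathcal X}$ be rational surfaces over $\mathbb C$, each obtained from $\mathbb P^1\times\mathbb P^1$ by a finite (possibly empty) sequence of blowups of points, possibly infinitely near, with blowdown maps $\pi:\mathcal X\to\mathbb P^1\times\mathbb P^1$ and $\bar\pi:\bar{\mathcal X}\to\mathbb P^1\times\mathbb P^1$. Let $\varphi:\mathbb P^1\times\mathbb P^1\dashrightarrow\mathbb P^1\times\mathbb P^1$, $\varphi(x,y)=(\bar x,\bar y)$, be a dominant rational map, and let $\tilde\varphi:\mathcal X\dashrightarrow\bar{\mathcal X}$ be its extension, so that $\bar\pi\circ\tilde\varphi=\varphi\circ\pi$ as rational maps; thus $\bar x,\bar y\in\mathbb C(x,y)$. Pull-backs of divisors under dominant rational maps of these smooth surfaces are formed by pulling back local equations at the generic points of prime divisors. Let $\bar x_1\ne\bar x_2$ and $\bar y_1\neq\bar y_2$ be points of $\mathbb P^1=\mathbb C\cup\{\infty\}$, and consider the prime divisors $\bar D_1=V(\bar x-\bar x_1)$, $\bar D_2=V(\bar x-\bar x_2)$, $\bar D_3=V(\bar y-\bar y_1)$, $\bar D_4=V(\bar y-\bar y_2)$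 on the target $\mathbb P^1\times\mathbb P^1$. Let $$\bar\pi^*(\bar D_i)=\sum_{j=1}^{J_i}n_{i,j}\bar D_{i,j},\qquad \tilde\varphi^*(\bar D_{i,j})=\sum_{k=1}^{K_{i,j}}m_{i,j,k}D'_{i,j,k}$$ be the expressions of the pull-backs in terms of distinct prime divisors. Let $D_{i,j,k}=\pi_*(D'_{i,j,k})$ (which is $0$ if $\pi$ contracts $D'_{i,j,k}$ to a point), and let $p_{i,j,k}(x,y)\in\mathbb C[x,y]$ be an irreducible defining polynomial of $D_{i,j,k}$ in the affine chart $(x,y)$, where $p_{i,j,k}=1$ if $D_{i,j,k}=0$ or if $D_{i,j,k}$ is one of the lines $x=\infty$, $y=\infty$. For $a\in\mathbb P^1$ put $l_a(t)=t-a$ if $a\neq\infty$, and $l_a(t)=1$ if $a=\infty$. Then there are nonzero constants $C_1,C_2\in\mathbb C$ such that, in $\mathbb C(x,y)$, $$\frac{l_{\bar x_1}(\bar x)}{l_{\bar x_2}(\bar x)}=C_1\,\frac{\prod_{j=1}^{J_1}\Bigl(\prod_{k=1}^{K_{1,j}}p_{1,j,k}(x,y)^{m_{1,j,k}}\Bigr)^{n_{1,j}}}{\prod_{j=1}^{J_2}\Bigl(\prod_{k=1}^{K_{2,j}}p_{2,j,k}(x,y)^{m_{2,j,k}}\Bigr)^{n_{2,j}}},\qquad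 \frac{l_{\bar y_1}(\bar y)}{l_{\bar y_2}(\bar y)}=C_2\,\frac{\prod_{j=1}^{J_3}\Bigl(\prod_{k=1}^{K_{3,j}}p_{3,j,k}(x,y)^{m_{3,j,k}}\Bigr)^{n_{3,j}}}{\prod_{j=1}^{J_4}\Bigl(\prod_{k=1}^{K_{4,j}}p_{4,j,k}(x,y)^{m_{4,j,k}}\Bigr)^{n_{4,j}}}.$$ -/

import Mathlib

open scoped OnePoint

noncomputable section

namespace BlowupFactorization

/-!
Surfaces birational to `ℙ¹ × ℙ¹` over `ℂ` are handled in the classical language of models: such a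
surface is the collection of the local rings of all its scheme points (the generic point, the
generic points of the irreducible curves, and the closed points), viewed as subrings of the common
function field `ℂ(x, y)`.

* A point `q` lies on the closure of a point `z` iff the local ring of `q` is contained in the
  local ring of `z`.
* A birational morphism `Y → X` identifying the function fields sends a point of `Y` to the unique
  point of `X` whose local ring is dominated by that of the given point.
* A dominant rational map `X ⇢ Y` is the same thing as a homomorphism of `ℂ`-algebras
  `ℂ(Y) → ℂ(X)` (its comorphism).
-/

/-- The field `ℂ(x, y)` of rational functions on `ℙ¹ × ℙ¹`. -/
abbrev RatFun : Type := FractionRing (MvPolynomial (Fin 2) ℂ)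

/-- A polynomial in `x` and `y`, viewed as a rational function. -/
def polyFun (p : MvPolynomial (Fin 2) ℂ) : RatFun := algebraMap (MvPolynomial (Fin 2) ℂ) RatFun p

/-- The affine coordinate `x` on the first factor. -/
def xFun : RatFun := polyFun (MvPolynomial.X 0)

/-- The affine coordinate `y` on the second factor. -/
def yFun : RatFun := polyFun (MvPolynomial.X 1)

/-- A collection of points, each of them given by its local ring inside `ℂ(x, y)`. -/
abbrev Model : Type := Set (LocalSubring RatFun)

/-- The maximal ideal of a local ring, i.e. the functions that vanish at the point. -/
def vanishingSet (R : LocalSubring RatFun) : Set RatFun :=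
  {a | ∃ h : a ∈ R.toSubring, (⟨a, h⟩ : R.toSubring) ∈ IsLocalRing.maximalIdeal R.toSubring}

/-- The affine variety `Spec A`: all localizations of `A` at its prime ideals. -/
def affineModel (A : Subring RatFun) : Model :=
  {R | ∃ (P : Ideal A) (_ : P.IsPrime), R = LocalSubring.ofPrime A P}

/-- The surface `ℙ¹ × ℙ¹`, the union of the four charts with affine coordinates
`(x, y)`, `(1/x, y)`, `(x, 1/y)` and `(1/x, 1/y)`. -/
def P1P1 : Model :=
  {R | ∃ u ∈ ({xFun, xFun⁻¹} : Set RatFun), ∃ v ∈ ({yFun, yFun⁻¹} : Set RatFun),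
    R ∈ affineModel (Algebra.adjoin ℂ {u, v}).toSubring}

/-- `R` is the local ring of a closed point: every element of `R` has a value in `ℂ`, that is,
the residue field is `ℂ`. -/
def IsClosedPoint (R : LocalSubring RatFun) : Prop :=
  ∀ a ∈ R.toSubring, ∃ c : ℂ, a - algebraMap ℂ RatFun c ∈ vanishingSet R

/-- The coordinate ring `R[𝔪/t]` of the chart of the blowup of `Spec R` at its closed point in
which the exceptional curve has the equation `t = 0`; here `𝔪` is the maximal ideal of `R`. -/
def blowupChart (R : LocalSubring RatFun) (t : RatFun) : Subring RatFun :=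
  Subring.closure ((R.toSubring : Set RatFun) ∪ {b | ∃ a ∈ vanishingSet R, b = a / t})

/-- The blowup of the surface `X` at the point `p`: the point `p` is removed, and the points of
the charts `Spec 𝒪_p[𝔪_p/t]`, `0 ≠ t ∈ 𝔪_p`, that lie over `p` are put in its place. -/
def blowup (X : Model) (p : LocalSubring RatFun) : Model :=
  (X \ {p}) ∪
    {S | ∃ t ∈ vanishingSet p, t ≠ 0 ∧ S ∈ affineModel (blowupChart p t) ∧ p ≤ S}

/-- The surfaces obtained from `ℙ¹ × ℙ¹` by a finite (possibly empty) sequence of blowups of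
closed points, each of them possibly infinitely near to the previous ones. The blowdown map to
`ℙ¹ × ℙ¹` is the one that induces the identity on `ℂ(x, y)`. -/
inductive IsBlownUpSurface : Model → Prop
  | base : IsBlownUpSurface P1P1
  | step (X : Model) (p : LocalSubring RatFun) (hX : IsBlownUpSurface X) (hp : p ∈ X)
      (hclosed : IsClosedPoint p) : IsBlownUpSurface (blowup X p)

/-- The prime divisors (irreducible curves) of a regular surface, given by their generic points:
the points of codimension one, i.e. those whose local ring is a discrete valuation ring. -/
abbrev PrimeDivisor (X : Model) : Type :=
  {R : LocalSubring RatFun // R ∈ X ∧ IsDiscreteValuationRing R.toSubring}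

/-- Weil divisors: finite formal integral combinations of distinct prime divisors. -/
abbrev WeilDiv (X : Model) : Type := PrimeDivisor X →₀ ℤ

/-- The nonzero rational function `f` has order `n` along the prime divisor with local ring `R`:
it is a unit of `R` times the `n`-th power of a uniformizer. -/
def HasOrder (R : LocalSubring RatFun) (f : RatFun) (n : ℤ) : Prop :=
  ∃ (ϖ : R.toSubring) (u : (R.toSubring)ˣ), Irreducible ϖ ∧
    f = ((u : R.toSubring) : RatFun) * (ϖ : RatFun) ^ n

/-- `g` is a local equation of the divisor `D` at the point `q`: the orders of `g` along all prime
divisors that pass through `q` are the coefficients of `D`. -/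
def IsLocalEquation {X : Model} (D : WeilDiv X) (q : LocalSubring RatFun) (g : RatFun) : Prop :=
  g ≠ 0 ∧ ∀ Z : PrimeDivisor X, q.toSubring ≤ Z.1.toSubring → HasOrder Z.1 g (D Z)

/-- The dominant rational map with comorphism `φ` is defined at the point with local ring `R` and
sends it to the point with local ring `q`: `φ(q) ⊆ R`, and this is a local homomorphism. -/
def MapsTo (φ : RatFun →ₐ[ℂ] RatFun) (R q : LocalSubring RatFun) : Prop :=
  q.map (φ : RatFun →+* RatFun) ≤ R

/-- `E` is the pull-back `φ^*(D)` of the divisor `D` on `Y` under the dominant rational map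
`X ⇢ Y` with comorphism `φ`: the coefficient of `E` at a prime divisor `R` is the order along `R`
of the composition with the map of a local equation of `D` at the image of (the generic point
of) `R`. -/
def IsPullback (φ : RatFun →ₐ[ℂ] RatFun) {X Y : Model} (D : WeilDiv Y) (E : WeilDiv X) : Prop :=
  ∀ R : PrimeDivisor X, ∃ q ∈ Y, MapsTo φ R.1 q ∧
    ∃ g : RatFun, IsLocalEquation D q g ∧ HasOrder R.1 (φ g) (E R)

open Classical in
/-- The push-forward of a prime divisor `W` of `X` under the birational morphism `X → Y` inducing
the identity on `ℂ(x, y)`: the image of `W` if it is a curve (the degree of `W` over its image is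
then one, the morphism being birational), and `0` if `W` is contracted to a point. -/
def pushforwardPrime {X : Model} (Y : Model) (W : PrimeDivisor X) : WeilDiv Y :=
  if h : ∃ Z : PrimeDivisor Y, Z.1 ≤ W.1 then Finsupp.single h.choose 1 else 0

/-- The push-forward of Weil divisors under the birational morphism `X → Y`. -/
def pushforward {X : Model} (Y : Model) (D : WeilDiv X) : WeilDiv Y :=
  D.sum fun W n => n • pushforwardPrime Y W

/-- The value of a nonconstant function `c` along the prime divisor with local ring `R` is the
point `a` of `ℙ¹ = ℂ ∪ {∞}`. -/
def HasValue (R : LocalSubring RatFun) (c : RatFun) (a : OnePoint ℂ) : Prop :=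
  a.elim (c⁻¹ ∈ vanishingSet R) fun b => c - algebraMap ℂ RatFun b ∈ vanishingSet R

/-- `D` is the divisor `V(c - a)` on `ℙ¹ × ℙ¹`, where `c` is one of the coordinates `x`, `y` and
`a ∈ ℙ¹`: the unique irreducible curve along which `c` is equal to `a`. -/
def IsCoordinateLine (c : RatFun) (a : OnePoint ℂ) (D : WeilDiv P1P1) : Prop :=
  ∃ Z : PrimeDivisor P1P1, HasValue Z.1 c a ∧ D = Finsupp.single Z 1

/-- The affine linear form `l(c)` that defines the point `a` of `ℙ¹`: it is `c - a` for finite `a`,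
and `1` for `a = ∞`. -/
def linForm (a : OnePoint ℂ) (c : RatFun) : RatFun :=
  a.elim 1 fun b => c - algebraMap ℂ RatFun b

/-- `p` is an irreducible defining polynomial in the affine coordinates `x`, `y` of the divisor
`D` on `ℙ¹ × ℙ¹`, where `D` is zero or a prime divisor. If `D` is a curve that meets the affine
chart `(x, y)`, then `p` is irreducible and generates the ideal of the curve. If `D` is zero or one
of the lines `x = ∞`, `y = ∞`, which do not meet the chart, then `p = 1`. -/
def IsDefiningPolynomial (D : WeilDiv P1P1) (p : MvPolynomial (Fin 2) ℂ) : Prop :=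
  (D = 0 ∧ p = 1) ∨
  ∃ Z : PrimeDivisor P1P1, D = Finsupp.single Z 1 ∧
    (((xFun ∈ Z.1.toSubring ∧ yFun ∈ Z.1.toSubring) ∧ Irreducible p ∧
        ∀ a : MvPolynomial (Fin 2) ℂ, polyFun a ∈ vanishingSet Z.1 ↔ p ∣ a) ∨
      (¬ (xFun ∈ Z.1.toSubring ∧ yFun ∈ Z.1.toSubring) ∧ p = 1))

/-- The product `∏ⱼ (∏ₖ pⱼₖ ^ mⱼₖ) ^ nⱼ`, where `A = ∑ⱼ nⱼ Aⱼ` and `B Aⱼ = ∑ₖ mⱼₖ Bⱼₖ` are the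
expressions in terms of distinct prime divisors, and `pⱼₖ = p Aⱼ Bⱼₖ`. -/
def factorProduct {X Y : Model} (A : WeilDiv Y) (B : PrimeDivisor Y → WeilDiv X)
    (p : PrimeDivisor Y → PrimeDivisor X → MvPolynomial (Fin 2) ℂ) : RatFun :=
  A.prod fun Z n => ((B Z).prod fun W m => polyFun (p Z W) ^ m) ^ n

end BlowupFactorization

end

open BlowupFactorization

/-!
The local rings of a blown-up surface are noetherian and factorial: in a chart of a blowup the
exceptional curve is an affine line, and unique factorization lifts from it by Nakayama's lemma.
Hence a rational function that has order zero along all curves through a point is a unit there,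
and so the divisor of a function pulls back to the divisor of the pulled back function. The
function `l_{x₁}(x) / l_{x₂}(x)` has the divisor `D₁ - D₂`; pulling it back to the blown-up target
and then to the source gives the divisor of `l_{x₁}(φ x) / l_{x₂}(φ x)`. The quotient of the
products of defining polynomials has the same order along every curve that meets the affine
plane, and a rational function without zeros and poles on the affine plane is constant.
-/

noncomputable section

namespace BlowupFactorization

/-! ### Local subrings of a field -/

section LocalSubring

variable {K : Type*} [Field K]

theorem isUnit_iff_ne_zero_and_inv_mem {A : Subring K} {a : A} :
    IsUnit a ↔ (a : K) ≠ 0 ∧ (a : K)⁻¹ ∈ A := by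
  refine ⟨fun h => ?_, fun ⟨h0, h⟩ =>
    IsUnit.of_mul_eq_one ⟨_, h⟩ (Subtype.ext (mul_inv_cancel₀ h0))⟩
  obtain ⟨b, hab⟩ := h.exists_right_inv
  have hab : (a : K) * b = 1 := congrArg Subtype.val hab
  exact ⟨left_ne_zero_of_mul_eq_one hab, eq_inv_of_mul_eq_one_right hab ▸ b.2⟩

theorem mem_maximalIdeal_iff_inv_mem {V : LocalSubring K} {a : V.toSubring} :
    a ∈ IsLocalRing.maximalIdeal V.toSubring ↔ ((a : K)⁻¹ ∈ V.toSubring → (a : K) = 0) := by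
  rw [IsLocalRing.mem_maximalIdeal, mem_nonunits_iff, isUnit_iff_ne_zero_and_inv_mem]
  tauto

theorem localSubring_le_iff_inv_mem {R S : LocalSubring K} :
    R ≤ S ↔ R.toSubring ≤ S.toSubring ∧
      ∀ a ∈ R.toSubring, a⁻¹ ∈ S.toSubring → a⁻¹ ∈ R.toSubring := by
  rw [LocalSubring.le_def]
  refine ⟨fun ⟨hle, hlocal⟩ => ⟨hle, fun a ha hinv => ?_⟩,
    fun ⟨hle, hinv⟩ => ⟨hle, ⟨fun a ha => ?_⟩⟩⟩
  · rcases eq_or_ne a 0 with rfl | h0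
    · simp
    · have hunit := hlocal.map_nonunit ⟨a, ha⟩ (isUnit_iff_ne_zero_and_inv_mem.2 ⟨h0, hinv⟩)
      exact (isUnit_iff_ne_zero_and_inv_mem.1 hunit).2
  · have hunit := isUnit_iff_ne_zero_and_inv_mem.1 ha
    exact isUnit_iff_ne_zero_and_inv_mem.2 ⟨hunit.1, hinv _ a.2 hunit.2⟩

theorem inv_mem_of_le {R S : LocalSubring K} (h : R ≤ S) {a : K} (ha : a ∈ R.toSubring)
    (hinv : a⁻¹ ∈ S.toSubring) : a⁻¹ ∈ R.toSubring :=
  (localSubring_le_iff_inv_mem.1 h).2 a ha hinv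

/-- The local ring `V` is the localization of the subring `A` of the field `K` at a prime ideal,
that is, the local ring of a point of `Spec A`. -/
def IsLocalizationOf (V : LocalSubring K) (A : Subring K) : Prop :=
  ∃ (P : Ideal A) (_ : P.IsPrime), V = LocalSubring.ofPrime A P

/-- The center on `Spec A` of a local ring containing `A`: the prime ideal of the functions in `A`
that vanish at its closed point. -/
def center (A : Subring K) (V : LocalSubring K) (h : A ≤ V.toSubring) : Ideal A :=
  (IsLocalRing.maximalIdeal V.toSubring).comap (Subring.inclusion h)

instance (A : Subring K) (V : LocalSubring K) (h : A ≤ V.toSubring) : (center A V h).IsPrime :=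
  Ideal.comap_isPrime _ _

theorem mem_center_iff_inv_mem {A : Subring K} {V : LocalSubring K} (h : A ≤ V.toSubring) {a : A} :
    a ∈ center A V h ↔ ((a : K)⁻¹ ∈ V.toSubring → (a : K) = 0) :=
  mem_maximalIdeal_iff_inv_mem

theorem center_ofPrime (A : Subring K) (P : Ideal A) [P.IsPrime] :
    center A (LocalSubring.ofPrime A P) (LocalSubring.le_ofPrime A P) = P :=
  IsLocalization.AtPrime.under_maximalIdeal _ P

theorem IsLocalizationOf.exists_eq_mul_inv {A : Subring K} {V : LocalSubring K}
    (h : IsLocalizationOf V A) {f : K} (hf : f ∈ V.toSubring) :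
    ∃ a ∈ A, ∃ s ∈ A, s ≠ 0 ∧ s⁻¹ ∈ V.toSubring ∧ f = a * s⁻¹ := by
  obtain ⟨P, _, rfl⟩ := h
  obtain ⟨⟨a, s⟩, hfs⟩ :=
    IsLocalization.surj P.primeCompl (⟨f, hf⟩ : (LocalSubring.ofPrime A P).toSubring)
  have hfs : f * ((s : A) : K) = a := congrArg Subtype.val hfs
  obtain ⟨h0, hinv⟩ := isUnit_iff_ne_zero_and_inv_mem.1
    (IsLocalization.map_units (LocalSubring.ofPrime A P).toSubring s)
  exact ⟨a, a.2, s, s.1.2, h0, hinv, (eq_mul_inv_iff_mul_eq₀ h0).2 hfs⟩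

theorem IsLocalizationOf.le {A : Subring K} {V : LocalSubring K} (h : IsLocalizationOf V A) :
    A ≤ V.toSubring := by
  obtain ⟨P, _, rfl⟩ := h
  exact LocalSubring.le_ofPrime A P

theorem isLocalizationOf_ofPrime (A : Subring K) (P : Ideal A) [P.IsPrime] :
    IsLocalizationOf (LocalSubring.ofPrime A P) A :=
  ⟨P, inferInstance, rfl⟩

theorem inv_mem_ofPrime_center_iff {A : Subring K} {V : LocalSubring K} (h : A ≤ V.toSubring)
    {s : K} (hs : s ∈ A) :
    s⁻¹ ∈ (LocalSubring.ofPrime A (center A V h)).toSubring ↔ s⁻¹ ∈ V.toSubring := by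
  rcases eq_or_ne s 0 with rfl | h0
  · simp
  have hmem : (⟨s, hs⟩ : A) ∈ center A _ (LocalSubring.le_ofPrime A (center A V h)) ↔
      (⟨s, hs⟩ : A) ∈ center A V h := by
    rw [center_ofPrime]
  simpa [mem_center_iff_inv_mem, h0, not_iff_not] using hmem

theorem ofPrime_center_le {A : Subring K} {V : LocalSubring K} (h : A ≤ V.toSubring) :
    LocalSubring.ofPrime A (center A V h) ≤ V := by
  have hfrac {f : K} := (isLocalizationOf_ofPrime A (center A V h)).exists_eq_mul_inv (f := f)
  refine localSubring_le_iff_inv_mem.2 ⟨fun f hf => ?_, fun f hf hinv => ?_⟩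
  · obtain ⟨a, ha, s, hs, -, hsinv, rfl⟩ := hfrac hf
    exact mul_mem (h ha) ((inv_mem_ofPrime_center_iff h hs).1 hsinv)
  · obtain ⟨a, ha, s, hs, h0, hsinv, rfl⟩ := hfrac hf
    rw [mul_inv, inv_inv] at hinv ⊢
    have hainv : a⁻¹ ∈ V.toSubring := by
      rw [← mul_inv_cancel_right₀ h0 a⁻¹]
      exact mul_mem hinv ((inv_mem_ofPrime_center_iff h hs).1 hsinv)
    exact mul_mem ((inv_mem_ofPrime_center_iff h ha).2 hainv) (LocalSubring.le_ofPrime _ _ hs)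

theorem isLocalizationOf_iff {A : Subring K} {V : LocalSubring K} :
    IsLocalizationOf V A ↔ A ≤ V.toSubring ∧
      ∀ f ∈ V.toSubring, ∃ a ∈ A, ∃ s ∈ A, s ≠ 0 ∧ s⁻¹ ∈ V.toSubring ∧ f = a * s⁻¹ := by
  refine ⟨fun h => ⟨h.le, fun f hf => h.exists_eq_mul_inv hf⟩, fun ⟨hle, hfrac⟩ =>
    ⟨center A V hle, inferInstance, LocalSubring.toSubring_injective
      (le_antisymm (fun f hf => ?_) (ofPrime_center_le hle).1)⟩⟩
  obtain ⟨a, ha, s, hs, -, hinv, rfl⟩ := hfrac f hf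
  exact mul_mem (LocalSubring.le_ofPrime _ _ ha) ((inv_mem_ofPrime_center_iff hle hs).2 hinv)

theorem isLocalizationOf_self (V : LocalSubring K) : IsLocalizationOf V V.toSubring :=
  isLocalizationOf_iff.2
    ⟨le_rfl, fun f hf => ⟨f, hf, 1, one_mem _, one_ne_zero, by simp, by simp⟩⟩

namespace IsLocalizationOf

variable {A B : Subring K} {S T V : LocalSubring K}

theorem trans (hV : IsLocalizationOf V S.toSubring) (hS : IsLocalizationOf S A) :
    IsLocalizationOf V A := by
  refine isLocalizationOf_iff.2 ⟨hS.le.trans hV.le, fun f hf => ?_⟩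
  obtain ⟨a, ha, s, hs, h0, hinv, rfl⟩ := hV.exists_eq_mul_inv hf
  obtain ⟨a₁, ha₁, b₁, hb₁, hb0, hbinv, rfl⟩ := hS.exists_eq_mul_inv ha
  obtain ⟨s₁, hs₁, c₁, hc₁, hc0, hcinv, rfl⟩ := hS.exists_eq_mul_inv hs
  have hs0 : s₁ ≠ 0 := left_ne_zero_of_mul h0
  refine ⟨a₁ * c₁, mul_mem ha₁ hc₁, b₁ * s₁, mul_mem hb₁ hs₁, mul_ne_zero hb0 hs0, ?_,
    by field_simp⟩
  have hsplit : (b₁ * s₁)⁻¹ = b₁⁻¹ * ((s₁ * c₁⁻¹)⁻¹ * c₁⁻¹) := by field_simp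
  exact hsplit ▸ mul_mem (hV.le hbinv) (mul_mem hinv (hV.le hcinv))

theorem le_of_le (hS : IsLocalizationOf S A) (hSV : S ≤ V) (hTV : T ≤ V) (hAT : A ≤ T.toSubring) :
    S.toSubring ≤ T.toSubring := by
  intro f hf
  obtain ⟨a, ha, s, hs, -, hinv, rfl⟩ := hS.exists_eq_mul_inv hf
  exact mul_mem (hAT ha) (inv_mem_of_le hTV (hAT hs) (hSV.1 hinv))

theorem eq_of_le (hS : IsLocalizationOf S A) (hT : IsLocalizationOf T B) (hSV : S ≤ V)
    (hTV : T ≤ V) (hAT : A ≤ T.toSubring) (hBS : B ≤ S.toSubring) : S = T :=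
  LocalSubring.toSubring_injective
    (le_antisymm (hS.le_of_le hSV hTV hAT) (hT.le_of_le hTV hSV hBS))

theorem isNoetherianRing [IsNoetherianRing A] (h : IsLocalizationOf V A) :
    IsNoetherianRing V.toSubring := by
  obtain ⟨P, _, rfl⟩ := h
  exact IsLocalization.isNoetherianRing P.primeCompl _ inferInstance

theorem uniqueFactorizationMonoid [UniqueFactorizationMonoid A] (h : IsLocalizationOf V A) :
    UniqueFactorizationMonoid V.toSubring := by
  obtain ⟨P, _, rfl⟩ := h
  exact UniqueFactorizationMonoid.of_isLocalization P.primeCompl _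

theorem map_comap_eq (h : IsLocalizationOf V A) (I : Ideal V.toSubring) :
    (I.comap (Subring.inclusion h.le)).map (Subring.inclusion h.le) = I := by
  obtain ⟨P, _, rfl⟩ := h
  exact IsLocalization.map_under P.primeCompl _ I

theorem maximalIdeal_eq_map_center (h : IsLocalizationOf V A) :
    IsLocalRing.maximalIdeal V.toSubring = (center A V h.le).map (Subring.inclusion h.le) :=
  (h.map_comap_eq _).symm

theorem prime_inclusion (h : IsLocalizationOf V A) {u : A} (hu : Prime u)
    (hmem : u ∈ center A V h.le) : Prime (Subring.inclusion h.le u) := by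
  obtain ⟨P, _, rfl⟩ := h
  rw [center_ofPrime] at hmem
  have hspan : (Ideal.span {u}).IsPrime := (Ideal.span_singleton_prime hu.ne_zero).2 hu
  have hmap := IsLocalization.isPrime_of_isPrime_disjoint P.primeCompl
    (LocalSubring.ofPrime A P).toSubring _ hspan
    (Set.disjoint_left.2 fun a ha ha' => ha ((Ideal.span_singleton_le_iff_mem P).2 hmem ha'))
  rw [Ideal.map_span, Set.image_singleton] at hmap
  refine (Ideal.span_singleton_prime fun h0 => hu.ne_zero ?_).1 hmap
  exact Subring.inclusion_injective _ (h0.trans (map_zero _).symm)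

end IsLocalizationOf

end LocalSubring

/-! ### Discrete valuation rings in the field of fractions -/

section DiscreteValuationRing

variable {K : Type*} [Field K] {A B : Subring K} {V W : LocalSubring K}

theorem isFractionRing_of_le [IsFractionRing A K] (h : A ≤ B) : IsFractionRing B K :=
  IsFractionRing.of_field B K fun f => by
    obtain ⟨a, b, -, hf⟩ := IsFractionRing.div_surjective (A := A) f
    exact ⟨Subring.inclusion h a, Subring.inclusion h b, hf.symm⟩

theorem eq_of_le_of_isDiscreteValuationRing [IsDiscreteValuationRing V.toSubring]
    [IsFractionRing V.toSubring K] (h : V ≤ W) : V = W := by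
  refine LocalSubring.toSubring_injective (le_antisymm h.1 fun f hf => ?_)
  rcases ValuationRing.isInteger_or_isInteger V.toSubring f with ⟨a, rfl⟩ | ⟨a, ha⟩
  · exact a.2
  · rw [← inv_inv f] at hf ⊢
    exact inv_mem_of_le h (ha ▸ a.2) hf

namespace IsLocalizationOf

theorem irreducible_inclusion [IsDiscreteValuationRing V.toSubring] (h : IsLocalizationOf V A)
    {u : A} (hu : center A V h.le = Ideal.span {u}) : Irreducible (Subring.inclusion h.le u) := by
  rw [IsDiscreteValuationRing.irreducible_iff_uniformizer, h.maximalIdeal_eq_map_center, hu,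
    Ideal.map_span, Set.image_singleton]

theorem isDiscreteValuationRing [IsNoetherianRing A] (h : IsLocalizationOf V A) {u : A}
    (hu0 : u ≠ 0) (hu : center A V h.le = Ideal.span {u}) :
    IsDiscreteValuationRing V.toSubring := by
  have := h.isNoetherianRing
  have hmax : IsLocalRing.maximalIdeal V.toSubring = Ideal.span {Subring.inclusion h.le u} := by
    rw [h.maximalIdeal_eq_map_center, hu, Ideal.map_span, Set.image_singleton]
  have hfield : ¬ IsField V.toSubring := by
    rw [IsLocalRing.isField_iff_maximalIdeal_eq, hmax, Ideal.span_singleton_eq_bot]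
    exact fun h0 => hu0 (Subring.inclusion_injective _ (h0.trans (map_zero _).symm))
  refine ((IsDiscreteValuationRing.TFAE V.toSubring hfield).out 0 4).2 ?_
  exact ⟨⟨_, hmax⟩⟩

theorem center_eq_span [IsDiscreteValuationRing V.toSubring] (h : IsLocalizationOf V A) {u : A}
    (hu : Prime u) (hmem : u ∈ center A V h.le) : center A V h.le = Ideal.span {u} := by
  have hmax := (IsDiscreteValuationRing.irreducible_iff_uniformizer _).1
    (h.prime_inclusion hu hmem).irreducible
  obtain ⟨P, _, rfl⟩ := h
  rw [center_ofPrime] at hmem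
  have hspan : (Ideal.span {u}).IsPrime := (Ideal.span_singleton_prime hu.ne_zero).2 hu
  have hcomap := IsLocalization.under_map_of_isPrime_disjoint P.primeCompl
    (LocalSubring.ofPrime A P).toSubring hspan
    (Set.disjoint_left.2 fun a ha ha' => ha
      ((Ideal.span_singleton_le_iff_mem P).2 hmem ha'))
  rw [Ideal.map_span, Set.image_singleton] at hcomap
  rw [center, hmax]
  exact hcomap

theorem eq_ofPrime_center (h : IsLocalizationOf V A) :
    V = LocalSubring.ofPrime A (center A V h.le) := by
  obtain ⟨P, _, rfl⟩ := h
  simp only [center_ofPrime]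

theorem eq_of_center_eq (hV : IsLocalizationOf V A) (hW : IsLocalizationOf W A)
    (h : center A V hV.le = center A W hW.le) : V = W := by
  rw [hV.eq_ofPrime_center, hW.eq_ofPrime_center]
  simp only [h]

end IsLocalizationOf

/- The algebraic form of Hartogs' theorem. -/
theorem mem_of_forall_isDiscreteValuationRing [IsNoetherianRing A] [UniqueFactorizationMonoid A]
    [IsFractionRing A K] {f : K}
    (h : ∀ V, IsLocalizationOf V A → IsDiscreteValuationRing V.toSubring → f ∈ V.toSubring) :
    f ∈ A := by
  suffices hden : IsUnit (IsFractionRing.den A f : A) by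
    obtain ⟨a, rfl⟩ := IsFractionRing.isInteger_of_isUnit_den hden
    exact a.2
  by_contra hden
  obtain ⟨u, hu, hdvd⟩ := WfDvdMonoid.exists_irreducible_factor hden
    (nonZeroDivisors.coe_ne_zero (IsFractionRing.den A f))
  have hprime : (Ideal.span {u}).IsPrime :=
    (Ideal.span_singleton_prime hu.ne_zero).2 (UniqueFactorizationMonoid.irreducible_iff_prime.1 hu)
  set V := LocalSubring.ofPrime A (Ideal.span {u})
  have hV : IsLocalizationOf V A := isLocalizationOf_ofPrime A _
  have hcenter : center A V hV.le = Ideal.span {u} := center_ofPrime A _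
  have hf : f ∈ V.toSubring := h V hV (hV.isDiscreteValuationRing hu.ne_zero hcenter)
  have hden_mem : (IsFractionRing.den A f : A) ∈ center A V hV.le := by
    rwa [hcenter, Ideal.mem_span_singleton]
  have hnum_mem : IsFractionRing.num A f ∈ center A V hV.le := by
    have heq : Subring.inclusion hV.le (IsFractionRing.num A f) =
        ⟨f, hf⟩ * Subring.inclusion hV.le (IsFractionRing.den A f) := by
      refine Subtype.ext ?_
      change algebraMap A K (IsFractionRing.num A f) = f * algebraMap A K (IsFractionRing.den A f)
      rw [IsFractionRing.num_mul_den_eq_num_iff_eq.2 rfl]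
    rw [center, Ideal.mem_comap, heq]
    exact Ideal.mul_mem_left _ _ hden_mem
  rw [hcenter, Ideal.mem_span_singleton] at hnum_mem
  exact hu.not_isUnit (IsFractionRing.num_den_reduced A f hnum_mem hdvd)

end DiscreteValuationRing

/-! ### Factoriality from a prime element with principal residue ring -/

section PrincipalQuotient

variable {A C : Type*} [CommRing A] [CommRing C]

theorem isPrincipalIdealRing_quotient_of_ker_eq [IsPrincipalIdealRing C] {f : A →+* C}
    (hf : Function.Surjective f) {I : Ideal A} (hker : RingHom.ker f = I) :
    IsPrincipalIdealRing (A ⧸ I) := by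
  subst hker
  exact IsPrincipalIdealRing.of_surjective (RingHom.quotientKerEquivOfSurjective hf).symm
    (RingHom.quotientKerEquivOfSurjective hf).symm.surjective

theorem prime_of_ker_eq_span [IsDomain C] {f : A →+* C} {u : A} (hu : u ≠ 0)
    (hker : RingHom.ker f = Ideal.span {u}) : Prime u :=
  (Ideal.span_singleton_prime hu).1 (hker ▸ RingHom.ker_isPrime f)

variable {u : A} [IsPrincipalIdealRing (A ⧸ Ideal.span {u})]

theorem exists_mem_and_le_span_pair (I : Ideal A) : ∃ g ∈ I, I ≤ Ideal.span {u, g} := by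
  obtain ⟨c, hc⟩ := IsPrincipalIdealRing.principal (I.map (Ideal.Quotient.mk (Ideal.span {u})))
  have hcI : c ∈ I.map (Ideal.Quotient.mk (Ideal.span {u})) :=
    hc ▸ Submodule.mem_span_singleton_self c
  obtain ⟨g, hg, rfl⟩ :=
    (Ideal.mem_map_iff_of_surjective _ Ideal.Quotient.mk_surjective).1 hcI
  refine ⟨g, hg, fun x hx => ?_⟩
  have hxI := Ideal.mem_map_of_mem (Ideal.Quotient.mk (Ideal.span {u})) hx
  rw [hc, Ideal.submodule_span_eq, Ideal.mem_span_singleton'] at hxI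
  obtain ⟨d, hd⟩ := hxI
  obtain ⟨d, rfl⟩ := Ideal.Quotient.mk_surjective d
  rw [← map_mul, Ideal.Quotient.eq, Ideal.mem_span_singleton'] at hd
  obtain ⟨e, he⟩ := hd
  exact Ideal.mem_span_pair.2 ⟨-e, d, by linear_combination -he⟩

theorem exists_eq_span_pair {I : Ideal A} (hu : u ∈ I) : ∃ g, I = Ideal.span {u, g} := by
  obtain ⟨g, hg, hle⟩ := exists_mem_and_le_span_pair (u := u) I
  exact ⟨g, le_antisymm hle (Ideal.span_le.2 (Set.pair_subset hu hg))⟩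

/- Modulo `u` the prime `P` is generated by some `g ∈ P`, and `P ∩ (u) = u P`, so that Nakayama's
lemma applies to `P ≤ (g) + u P`. -/
theorem isPrincipal_of_notMem [IsNoetherianRing A] (hu : u ∈ Ideal.jacobson (⊥ : Ideal A))
    (P : Ideal A) [P.IsPrime] (huP : u ∉ P) : ∃ g, P = Ideal.span {g} := by
  obtain ⟨g, hg, hle⟩ := exists_mem_and_le_span_pair (u := u) P
  refine ⟨g, le_antisymm ?_ ((Ideal.span_singleton_le_iff_mem _).2 hg)⟩
  refine Submodule.le_of_le_smul_of_le_jacobson_bot (I := Ideal.span {u})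
    (IsNoetherian.noetherian P) ((Ideal.span_singleton_le_iff_mem _).2 hu) fun x hx => ?_
  obtain ⟨c, d, rfl⟩ := Ideal.mem_span_pair.1 (hle hx)
  have hcu : c * u ∈ P := (P.add_mem_iff_left (P.mul_mem_left d hg)).1 hx
  have hc : c ∈ P := (Ideal.IsPrime.mem_or_mem ‹_› hcu).resolve_right huP
  rw [add_comm, mul_comm c]
  exact add_mem
    (Ideal.mem_sup_left (Ideal.mul_mem_left _ _ (Ideal.mem_span_singleton_self g)))
    (Ideal.mem_sup_right (Submodule.smul_mem_smul (Ideal.mem_span_singleton_self u) hc))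

theorem uniqueFactorizationMonoid_of_prime [IsDomain A] [IsNoetherianRing A] (hp : Prime u)
    (hu : u ∈ Ideal.jacobson (⊥ : Ideal A)) : UniqueFactorizationMonoid A := by
  refine UniqueFactorizationMonoid.iff_exists_prime_mem_of_isPrime.2 fun P hP0 hP => ?_
  by_cases huP : u ∈ P
  · exact ⟨u, huP, hp⟩
  · obtain ⟨g, rfl⟩ := isPrincipal_of_notMem hu P huP
    have hg0 : g ≠ 0 := fun hg0 => hP0 (by simp [hg0])
    exact ⟨g, Ideal.mem_span_singleton_self g, (Ideal.span_singleton_prime hg0).1 hP⟩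

end PrincipalQuotient

section RegularPoint

variable {K : Type*} [Field K] {A : Subring K} {V : LocalSubring K}

/-- The local rings that occur on a regular surface with function field `K`. Regularity enters
through factoriality and through the two generators of the maximal ideal (which is zero at the
generic point and principal at the generic points of curves). -/
structure IsRegularPoint (V : LocalSubring K) : Prop where
  isNoetherianRing : IsNoetherianRing V.toSubring
  uniqueFactorizationMonoid : UniqueFactorizationMonoid V.toSubring
  isFractionRing : IsFractionRing V.toSubring K
  exists_maximalIdeal_eq : ∃ a b, IsLocalRing.maximalIdeal V.toSubring = Ideal.span {a, b}

namespace IsLocalizationOf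

theorem isPrincipalIdealRing_quotient (h : IsLocalizationOf V A) (u : A)
    [IsPrincipalIdealRing (A ⧸ Ideal.span {u})] :
    IsPrincipalIdealRing (V.toSubring ⧸ Ideal.span {Subring.inclusion h.le u}) := by
  refine ⟨fun J => ?_⟩
  set mk := Ideal.Quotient.mk (Ideal.span {Subring.inclusion h.le u})
  have hu : Subring.inclusion h.le u ∈ J.comap mk := by
    rw [Ideal.mem_comap, Ideal.Quotient.eq_zero_iff_mem.2 (Ideal.mem_span_singleton_self _)]
    exact J.zero_mem
  obtain ⟨g, hg⟩ :=
    exists_eq_span_pair (u := u) (I := (J.comap mk).comap (Subring.inclusion h.le)) hu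
  have hJ : J = Ideal.span {mk (Subring.inclusion h.le u), mk (Subring.inclusion h.le g)} := by
    rw [← Ideal.map_comap_of_surjective mk Ideal.Quotient.mk_surjective J,
      ← h.map_comap_eq (J.comap mk), hg]
    simp only [Ideal.map_span, Set.image_pair]
  rw [Ideal.Quotient.eq_zero_iff_mem.2 (Ideal.mem_span_singleton_self _),
    Ideal.span_insert_zero] at hJ
  exact ⟨⟨_, hJ⟩⟩

theorem isRegularPoint_of_uniqueFactorizationMonoid [IsNoetherianRing A]
    [UniqueFactorizationMonoid A] [IsFractionRing A K] (h : IsLocalizationOf V A)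
    (hcenter : ∃ a b, center A V h.le = Ideal.span {a, b}) : IsRegularPoint V where
  isNoetherianRing := h.isNoetherianRing
  uniqueFactorizationMonoid := h.uniqueFactorizationMonoid
  isFractionRing := isFractionRing_of_le h.le
  exists_maximalIdeal_eq := by
    obtain ⟨a, b, hab⟩ := hcenter
    exact ⟨_, _, by rw [h.maximalIdeal_eq_map_center, hab, Ideal.map_span, Set.image_pair]⟩

theorem isRegularPoint_of_prime [IsNoetherianRing A] [IsFractionRing A K]
    (h : IsLocalizationOf V A) {u : A} [IsPrincipalIdealRing (A ⧸ Ideal.span {u})]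
    (hu : Prime u) (hmem : u ∈ center A V h.le) : IsRegularPoint V := by
  have := h.isNoetherianRing
  have := h.isPrincipalIdealRing_quotient u
  have hjacobson : Subring.inclusion h.le u ∈ Ideal.jacobson (⊥ : Ideal V.toSubring) := by
    rw [IsLocalRing.jacobson_eq_maximalIdeal _ bot_ne_top]
    exact hmem
  obtain ⟨g, hg⟩ := exists_eq_span_pair (u := Subring.inclusion h.le u)
    (I := IsLocalRing.maximalIdeal V.toSubring) hmem
  exact ⟨h.isNoetherianRing,
    uniqueFactorizationMonoid_of_prime (h.prime_inclusion hu hmem) hjacobson,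
    isFractionRing_of_le h.le, _, g, hg⟩

end IsLocalizationOf

end RegularPoint

/-! ### Blowups of points -/

section LocalRing

variable {A : Type*} [CommRing A] [IsLocalRing A]

open IsLocalRing

theorem irreducible_of_mem_maximalIdeal_of_notMem_sq {t : A} (ht : t ∈ maximalIdeal A)
    (ht2 : t ∉ maximalIdeal A ^ 2) : Irreducible t := by
  refine ⟨(mem_maximalIdeal t).1 ht, fun a b hab => ?_⟩
  by_contra! h
  rw [hab, sq] at ht2
  exact ht2 (Ideal.mul_mem_mul ((mem_maximalIdeal a).2 h.1) ((mem_maximalIdeal b).2 h.2))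

theorem exists_maximalIdeal_eq_span_pair {t : A} (ht : t ∈ maximalIdeal A)
    (ht2 : t ∉ maximalIdeal A ^ 2) (hm : ∃ a b, maximalIdeal A = Ideal.span {a, b}) :
    ∃ w, maximalIdeal A = Ideal.span {t, w} := by
  obtain ⟨a, b, hab⟩ := hm
  have ha : a ∈ maximalIdeal A := hab ▸ Ideal.mem_span_pair.2 ⟨1, 0, by ring⟩
  have hb : b ∈ maximalIdeal A := hab ▸ Ideal.mem_span_pair.2 ⟨0, 1, by ring⟩
  obtain ⟨c, d, rfl⟩ := Ideal.mem_span_pair.1 (hab ▸ ht)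
  have hunit : IsUnit c ∨ IsUnit d := by
    by_contra! h
    rw [sq] at ht2
    exact ht2 (add_mem (Ideal.mul_mem_mul ((mem_maximalIdeal c).2 h.1) ha)
      (Ideal.mul_mem_mul ((mem_maximalIdeal d).2 h.2) hb))
  rcases hunit with hc | hd
  · exact ⟨b, by rw [Ideal.span_pair_add_mul_right, hab, Ideal.span_insert, Ideal.span_insert,
      Ideal.span_singleton_mul_left_unit hc]⟩
  · exact ⟨a, by rw [add_comm, Ideal.span_pair_add_mul_right, hab, Ideal.span_insert,
      Ideal.span_insert, Ideal.span_singleton_mul_left_unit hd, sup_comm]⟩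

end LocalRing

open Polynomial in
/- By Gauss' lemma it suffices to divide by the root over the field of fractions. -/
theorem linear_dvd_of_aeval_div_eq_zero {A K : Type*} [CommRing A] [IsDomain A]
    [UniqueFactorizationMonoid A] [Field K] [Algebra A K] [IsFractionRing A K] {t w : A}
    (ht : t ≠ 0) (htw : IsRelPrime t w) {F : A[X]}
    (hF : aeval (algebraMap A K w / algebraMap A K t) F = 0) : C t * X - C w ∣ F := by
  have ht0 : algebraMap A K t ≠ 0 := by simpa using ht
  have hprim : (C t * X - C w).IsPrimitive := fun r hr => by
    rw [C_dvd_iff_dvd_coeff] at hr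
    exact htw (by simpa using hr 1) (by simpa using hr 0)
  have hroot : X - C (algebraMap A K w / algebraMap A K t) ∣ F.map (algebraMap A K) := by
    rwa [dvd_iff_isRoot, IsRoot.def, eval_map_algebraMap]
  have hlinear : (C t * X - C w).map (algebraMap A K) =
      C (algebraMap A K t) * (X - C (algebraMap A K w / algebraMap A K t)) := by
    rw [mul_sub, ← C_mul, mul_div_cancel₀ _ ht0]
    simp
  refine hprim.dvd_of_fraction_map_dvd_fraction_map (K := K) ?_
  rwa [hlinear, (isUnit_C.2 ht0.isUnit).mul_left_dvd]

section VanishingSet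

variable {R S : LocalSubring RatFun}

theorem coe_mem_vanishingSet_iff {a : R.toSubring} :
    (a : RatFun) ∈ vanishingSet R ↔ a ∈ IsLocalRing.maximalIdeal R.toSubring :=
  ⟨fun ⟨_, h⟩ => h, fun h => ⟨a.2, h⟩⟩

theorem mem_vanishingSet_iff {f : RatFun} :
    f ∈ vanishingSet R ↔ f ∈ R.toSubring ∧ (f⁻¹ ∈ R.toSubring → f = 0) :=
  ⟨fun ⟨hf, h⟩ => ⟨hf, mem_maximalIdeal_iff_inv_mem.1 h⟩,
    fun ⟨hf, h⟩ => ⟨hf, mem_maximalIdeal_iff_inv_mem.2 h⟩⟩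

theorem mem_vanishingSet_iff_of_le (h : R ≤ S) {f : RatFun} (hf : f ∈ R.toSubring) :
    f ∈ vanishingSet S ↔ f ∈ vanishingSet R := by
  rw [mem_vanishingSet_iff, mem_vanishingSet_iff]
  have hfS := h.1 hf
  have hinv : f⁻¹ ∈ S.toSubring ↔ f⁻¹ ∈ R.toSubring := ⟨inv_mem_of_le h hf, fun hinv => h.1 hinv⟩
  tauto

theorem inclusion_mem_maximalIdeal (h : R ≤ S) {a : R.toSubring}
    (ha : a ∈ IsLocalRing.maximalIdeal R.toSubring) :
    Subring.inclusion h.1 a ∈ IsLocalRing.maximalIdeal S.toSubring :=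
  coe_mem_vanishingSet_iff.1
    ((mem_vanishingSet_iff_of_le h a.2).2 (coe_mem_vanishingSet_iff.2 ha))

end VanishingSet

section BlowupChart

open IsLocalRing Polynomial

variable {R S : LocalSubring RatFun} {t w : R.toSubring}

theorem le_blowupChart {t : RatFun} : R.toSubring ≤ blowupChart R t :=
  fun _ ha => Subring.subset_closure (Or.inl ha)

theorem div_mem_blowupChart {a t : RatFun} (ha : a ∈ vanishingSet R) : a / t ∈ blowupChart R t :=
  Subring.subset_closure (Or.inr ⟨a, ha, rfl⟩)

theorem blowupChart_le {t : RatFun} {T : Subring RatFun} (h : R.toSubring ≤ T)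
    (hdiv : ∀ a ∈ vanishingSet R, a / t ∈ T) : blowupChart R t ≤ T := by
  rw [blowupChart, Subring.closure_le]
  rintro x (hx | ⟨a, ha, rfl⟩)
  · exact h hx
  · exact hdiv a ha

theorem map_maximalIdeal_eq_span {T : Subring RatFun} (ht : t ∈ maximalIdeal R.toSubring)
    (ht0 : t ≠ 0) (h : blowupChart R t ≤ T) :
    (maximalIdeal R.toSubring).map (Subring.inclusion (le_blowupChart.trans h)) =
      Ideal.span {Subring.inclusion (le_blowupChart.trans h) t} := by
  refine le_antisymm (Ideal.map_le_iff_le_comap.2 fun a ha => ?_)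
    ((Ideal.span_singleton_le_iff_mem _).2 (Ideal.mem_map_of_mem _ ht))
  have hdiv : (a / t : RatFun) ∈ T := h (div_mem_blowupChart (coe_mem_vanishingSet_iff.2 ha))
  have ht0 : (t : RatFun) ≠ 0 := by simpa using ht0
  exact Ideal.mem_span_singleton'.2 ⟨⟨_, hdiv⟩, Subtype.ext (div_mul_cancel₀ _ ht0)⟩

theorem notMem_maximalIdeal_sq_of_blowupChart_le (ht : t ∈ maximalIdeal R.toSubring) (ht0 : t ≠ 0)
    (hRS : R ≤ S) (h : blowupChart R t ≤ S.toSubring) : t ∉ maximalIdeal R.toSubring ^ 2 := by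
  intro ht2
  have htS := Ideal.mem_map_of_mem (Subring.inclusion hRS.1) ht2
  rw [Ideal.map_pow, map_maximalIdeal_eq_span ht ht0 h, Ideal.span_singleton_pow,
    Ideal.mem_span_singleton, sq] at htS
  have ht0S : Subring.inclusion hRS.1 t ≠ 0 :=
    (map_ne_zero_iff _ (Subring.inclusion_injective hRS.1)).2 ht0
  exact (mem_maximalIdeal _).1 (inclusion_mem_maximalIdeal hRS ht)
    (isUnit_of_dvd_one ((mul_dvd_mul_iff_left ht0S).1 (by rwa [mul_one])))

theorem blowupChart_eq_of_maximalIdeal_eq_span (ht0 : t ≠ 0)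
    (hm : maximalIdeal R.toSubring = Ideal.span {t}) : blowupChart R t = R.toSubring := by
  refine le_antisymm (blowupChart_le le_rfl ?_) le_blowupChart
  rintro a ⟨haR, ha⟩
  obtain ⟨c, hc⟩ := Ideal.mem_span_singleton.1 (hm ▸ ha)
  have hc : a = t * c := congrArg Subtype.val hc
  have ht0 : (t : RatFun) ≠ 0 := by simpa using ht0
  rw [hc, mul_div_cancel_left₀ _ ht0]
  exact c.2

/-- The presentation `R[X] → R[𝔪/t]`, `X ↦ w/t`, of the chart of a blowup in which `t` is an
equation of the exceptional curve, where `𝔪` is generated by `t` and `w`. -/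
def chartHom (t : R.toSubring) (hw : w ∈ maximalIdeal R.toSubring) :
    R.toSubring[X] →+* blowupChart R t :=
  eval₂RingHom (Subring.inclusion le_blowupChart)
    ⟨w / t, div_mem_blowupChart (coe_mem_vanishingSet_iff.2 hw)⟩

theorem coe_chartHom (hw : w ∈ maximalIdeal R.toSubring) (F : R.toSubring[X]) :
    (chartHom t hw F : RatFun) = aeval (w / t : RatFun) F :=
  hom_eval₂ F (Subring.inclusion le_blowupChart) (blowupChart R t).subtype
    ⟨w / t, div_mem_blowupChart (coe_mem_vanishingSet_iff.2 hw)⟩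

theorem chartHom_surjective (ht0 : t ≠ 0) (hw : w ∈ maximalIdeal R.toSubring)
    (hm : maximalIdeal R.toSubring = Ideal.span {t, w}) :
    Function.Surjective (chartHom t hw) := by
  have ht0 : (t : RatFun) ≠ 0 := by simpa using ht0
  have hle : blowupChart R t ≤ ((blowupChart R t).subtype.comp (chartHom t hw)).range := by
    refine blowupChart_le (fun a ha => ⟨C ⟨a, ha⟩, ?_⟩) ?_
    · simp [chartHom]
    · rintro a ⟨haR, ha⟩
      obtain ⟨c, d, hcd⟩ := Ideal.mem_span_pair.1 (hm ▸ ha)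
      have hcd : (c * t + d * w : RatFun) = a := congrArg Subtype.val hcd
      refine ⟨C c + C d * X, ?_⟩
      rw [← hcd]
      simp [chartHom]
      field_simp
  exact fun b => (hle b.2).imp fun F hF => Subtype.ext hF

theorem map_residue_eq_zero_of_chartHom_eq_zero [UniqueFactorizationMonoid R.toSubring]
    [IsFractionRing R.toSubring RatFun] (ht : t ∈ maximalIdeal R.toSubring) (ht0 : t ≠ 0)
    (hw : w ∈ maximalIdeal R.toSubring) (htw : IsRelPrime t w) {F : R.toSubring[X]}
    (hF : chartHom t hw F = 0) : F.map (residue R.toSubring) = 0 := by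
  obtain ⟨G, rfl⟩ := linear_dvd_of_aeval_div_eq_zero ht0 htw
    (F := F) (K := RatFun) ((coe_chartHom hw F).symm.trans (congrArg Subtype.val hF))
  simp [(residue_eq_zero_iff _).2 ht, (residue_eq_zero_iff _).2 hw]

/- The exceptional curve is an affine line in each chart. -/
theorem exists_surjective_ker_eq_span [UniqueFactorizationMonoid R.toSubring]
    [IsFractionRing R.toSubring RatFun] (ht : t ∈ maximalIdeal R.toSubring) (ht0 : t ≠ 0)
    (hm : maximalIdeal R.toSubring = Ideal.span {t, w}) (htw : IsRelPrime t w) :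
    ∃ f : blowupChart R t →+* (ResidueField R.toSubring)[X], Function.Surjective f ∧
      RingHom.ker f = Ideal.span {Subring.inclusion le_blowupChart t} := by
  have hw : w ∈ maximalIdeal R.toSubring := hm ▸ Ideal.mem_span_pair.2 ⟨0, 1, by ring⟩
  have hsurj := chartHom_surjective ht0 hw hm
  set f := (chartHom t hw).liftOfSurjective hsurj
    ⟨mapRingHom (residue R.toSubring), fun F hF =>
      map_residue_eq_zero_of_chartHom_eq_zero ht ht0 hw htw hF⟩
  have hf : f.comp (chartHom t hw) = mapRingHom (residue R.toSubring) :=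
    RingHom.liftOfRightInverse_comp _ _ _ _
  refine ⟨f, ?_, ?_⟩
  · refine Function.Surjective.of_comp (g := chartHom t hw) ?_
    rw [← RingHom.coe_comp, hf]
    exact map_surjective _ residue_surjective
  · have hC : (chartHom t hw).comp C = Subring.inclusion le_blowupChart := by
      ext; simp [chartHom]
    rw [← Ideal.map_comap_of_surjective _ hsurj (RingHom.ker f), RingHom.comap_ker, hf,
      ker_mapRingHom, Ideal.map_map, hC, ker_residue]
    exact map_maximalIdeal_eq_span ht ht0 le_rfl

theorem IsRegularPoint.of_isLocalizationOf_blowupChart (hR : IsRegularPoint R) (hRS : R ≤ S)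
    (ht : t ∈ maximalIdeal R.toSubring) (ht0 : t ≠ 0)
    (hS : IsLocalizationOf S (blowupChart R t)) : IsRegularPoint S := by
  have := hR.isNoetherianRing
  have := hR.uniqueFactorizationMonoid
  have := hR.isFractionRing
  have ht2 := notMem_maximalIdeal_sq_of_blowupChart_le ht ht0 hRS hS.le
  have hirr := irreducible_of_mem_maximalIdeal_of_notMem_sq ht ht2
  obtain ⟨w, hm⟩ := exists_maximalIdeal_eq_span_pair ht ht2 hR.exists_maximalIdeal_eq
  by_cases htw : t ∣ w
  · have hchart : blowupChart R t = R.toSubring :=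
      blowupChart_eq_of_maximalIdeal_eq_span ht0
        (hm.trans (Ideal.span_pair_eq_span_left_iff_dvd.2 htw))
    rw [hchart] at hS
    exact (isLocalizationOf_self R).eq_of_le hS hRS le_rfl hRS.1 le_rfl ▸ hR
  · obtain ⟨f, hf, hker⟩ := exists_surjective_ker_eq_span ht ht0 hm
      (hirr.isRelPrime_iff_not_dvd.2 htw)
    have hw : w ∈ maximalIdeal R.toSubring := hm ▸ Ideal.mem_span_pair.2 ⟨0, 1, by ring⟩
    have : IsNoetherianRing (blowupChart R t) :=
      isNoetherianRing_of_surjective _ _ _ (chartHom_surjective ht0 hw hm)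
    have := isPrincipalIdealRing_quotient_of_ker_eq hf hker
    have : IsFractionRing (blowupChart R t) RatFun := isFractionRing_of_le le_blowupChart
    refine hS.isRegularPoint_of_prime (prime_of_ker_eq_span ?_ hker)
      (inclusion_mem_maximalIdeal hRS ht)
    exact (map_ne_zero_iff _ (Subring.inclusion_injective _)).2 ht0

end BlowupChart

/-! ### Regular models -/

section RegularModel

variable {X : Model} {p q V : LocalSubring RatFun}

/-- The properties of the surfaces obtained from `ℙ¹ × ℙ¹` by blowups that the theory of their
divisors rests on: regularity, separatedness, and that they contain the generic points of the
curves through each of their points. -/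
structure IsRegularModel (X : Model) : Prop where
  isRegularPoint : ∀ q ∈ X, IsRegularPoint q
  eq_of_le : ∀ q₁ ∈ X, ∀ q₂ ∈ X, ∀ V, q₁ ≤ V → q₂ ≤ V → q₁ = q₂
  mem_of_isLocalizationOf : ∀ q ∈ X, ∀ V, IsLocalizationOf V q.toSubring →
    IsDiscreteValuationRing V.toSubring → V ∈ X

theorem mem_blowup_of_isDiscreteValuationRing (hV : V ∈ X) [IsDiscreteValuationRing V.toSubring] :
    V ∈ blowup X p := by
  by_cases h : V = p
  · subst h
    obtain ⟨t, ht⟩ := IsDiscreteValuationRing.exists_irreducible V.toSubring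
    have hchart := blowupChart_eq_of_maximalIdeal_eq_span ht.ne_zero
      ((IsDiscreteValuationRing.irreducible_iff_uniformizer t).1 ht)
    refine Or.inr ⟨t, coe_mem_vanishingSet_iff.2 ht.not_isUnit, by simpa using ht.ne_zero, ?_,
      le_rfl⟩
    rw [hchart]
    exact isLocalizationOf_self V
  · exact Or.inl ⟨hV, h⟩

theorem blowupChart_le_of_le {R S₁ S₂ : LocalSubring RatFun} {t₁ t₂ : RatFun}
    (ht₁ : t₁ ∈ vanishingSet R) (ht₂ : t₂ ∈ vanishingSet R) (ht₂0 : t₂ ≠ 0)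
    (h₁ : blowupChart R t₁ ≤ S₁.toSubring) (h₂ : blowupChart R t₂ ≤ S₂.toSubring)
    (h₁V : S₁ ≤ V) (h₂V : S₂ ≤ V) : blowupChart R t₁ ≤ S₂.toSubring := by
  have hunit : t₂ / t₁ ∈ S₂.toSubring := by
    have hinv : (t₁ / t₂)⁻¹ ∈ V.toSubring :=
      h₁V.1 (inv_div t₁ t₂ ▸ h₁ (div_mem_blowupChart ht₂))
    exact inv_div t₁ t₂ ▸ inv_mem_of_le h₂V (h₂ (div_mem_blowupChart ht₁)) hinv
  refine blowupChart_le (le_blowupChart.trans h₂) fun a ha => ?_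
  rw [← div_mul_div_cancel₀ ht₂0]
  exact mul_mem (h₂ (div_mem_blowupChart ha)) hunit

/- Outside the exceptional curve some function vanishing at `p` is invertible, and so is `t`. -/
theorem isLocalizationOf_of_not_le {t : RatFun} (ht : t ∈ vanishingSet p)
    (hV : IsLocalizationOf V (blowupChart p t)) (hpV : ¬ p ≤ V) :
    IsLocalizationOf V p.toSubring := by
  have hle : p.toSubring ≤ V.toSubring := le_blowupChart.trans hV.le
  have htV : t⁻¹ ∈ V.toSubring := by
    simp only [localSubring_le_iff_inv_mem, hle, true_and, not_forall] at hpV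
    obtain ⟨a, ha, hinv, hnotMem⟩ := hpV
    have ha0 : a ≠ 0 := fun ha0 => hnotMem (by simp [ha0])
    have hdiv : a / t ∈ V.toSubring := hV.le (div_mem_blowupChart
      (mem_vanishingSet_iff.2 ⟨ha, fun h => absurd h hnotMem⟩))
    have hmul := mul_mem hinv hdiv
    rwa [div_eq_mul_inv, inv_mul_cancel_left₀ ha0] at hmul
  have hdom := ofPrime_center_le hle
  have hlocal := LocalSubring.le_ofPrime p.toSubring (center p.toSubring V hle)
  rw [hV.eq_of_le (isLocalizationOf_ofPrime _ _) le_rfl hdom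
    (blowupChart_le hlocal fun a ha => ?_) hle]
  · exact isLocalizationOf_ofPrime _ _
  · exact mul_mem (hlocal ha.1) (inv_mem_of_le hdom (hlocal ht.1) htV)

namespace IsRegularModel

theorem isRegularPoint_of_mem_blowup (hX : IsRegularModel X) (hp : p ∈ X)
    (hq : q ∈ blowup X p) : IsRegularPoint q := by
  rcases hq with ⟨hq, -⟩ | ⟨t, ⟨htR, ht⟩, ht0, hq, hpq⟩
  · exact hX.isRegularPoint q hq
  · exact (hX.isRegularPoint p hp).of_isLocalizationOf_blowupChart (t := ⟨t, htR⟩) hpq ht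
      (fun h => ht0 (congrArg Subtype.val h)) hq

theorem eq_of_le_of_mem_blowup {q₁ q₂ : LocalSubring RatFun} (hX : IsRegularModel X) (hp : p ∈ X)
    (hq₁ : q₁ ∈ blowup X p) (hq₂ : q₂ ∈ blowup X p)
    (h₁ : q₁ ≤ V) (h₂ : q₂ ≤ V) : q₁ = q₂ := by
  rcases hq₁ with ⟨hq₁, hne₁⟩ | ⟨t₁, ht₁, ht₁0, hq₁, hpq₁⟩ <;>
    rcases hq₂ with ⟨hq₂, hne₂⟩ | ⟨t₂, ht₂, ht₂0, hq₂, hpq₂⟩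
  · exact hX.eq_of_le q₁ hq₁ q₂ hq₂ V h₁ h₂
  · exact absurd (hX.eq_of_le q₁ hq₁ p hp V h₁ (hpq₂.trans h₂)) hne₁
  · exact absurd (hX.eq_of_le q₂ hq₂ p hp V h₂ (hpq₁.trans h₁)) hne₂
  · have hq₁ : IsLocalizationOf q₁ (blowupChart p t₁) := hq₁
    have hq₂ : IsLocalizationOf q₂ (blowupChart p t₂) := hq₂
    exact hq₁.eq_of_le hq₂ h₁ h₂
      (blowupChart_le_of_le ht₁ ht₂ ht₂0 hq₁.le hq₂.le h₁ h₂)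
      (blowupChart_le_of_le ht₂ ht₁ ht₁0 hq₂.le hq₁.le h₂ h₁)

theorem mem_blowup_of_isLocalizationOf (hX : IsRegularModel X) (hp : p ∈ X)
    (hq : q ∈ blowup X p) (hV : IsLocalizationOf V q.toSubring)
    [IsDiscreteValuationRing V.toSubring] : V ∈ blowup X p := by
  rcases hq with ⟨hq, -⟩ | ⟨t, ht, ht0, hq, -⟩
  · exact mem_blowup_of_isDiscreteValuationRing (hX.mem_of_isLocalizationOf q hq V hV ‹_›)
  · have hVt : IsLocalizationOf V (blowupChart p t) := hV.trans hq
    by_cases hpV : p ≤ V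
    · exact Or.inr ⟨t, ht, ht0, hVt, hpV⟩
    · exact mem_blowup_of_isDiscreteValuationRing
        (hX.mem_of_isLocalizationOf p hp V (isLocalizationOf_of_not_le ht hVt hpV) ‹_›)

protected theorem blowup (hX : IsRegularModel X) (hp : p ∈ X) :
    IsRegularModel (blowup X p) where
  isRegularPoint _ hq := hX.isRegularPoint_of_mem_blowup hp hq
  eq_of_le _ hq₁ _ hq₂ _ h₁ h₂ := hX.eq_of_le_of_mem_blowup hp hq₁ hq₂ h₁ h₂
  mem_of_isLocalizationOf _ hq _ hV _ := hX.mem_blowup_of_isLocalizationOf hp hq hV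

end IsRegularModel

end RegularModel

/-! ### Orders along prime divisors -/

section Order

variable {R : LocalSubring RatFun} {f g : RatFun} {m n : ℤ}

theorem HasOrder.ne_zero (h : HasOrder R f n) : f ≠ 0 := by
  obtain ⟨ϖ, u, hϖ, rfl⟩ := h
  exact mul_ne_zero (ZeroMemClass.coe_eq_zero.not.2 u.ne_zero)
    (zpow_ne_zero _ (ZeroMemClass.coe_eq_zero.not.2 hϖ.ne_zero))

theorem hasOrder_one_of_irreducible {ϖ : R.toSubring} (h : Irreducible ϖ) :
    HasOrder R (ϖ : RatFun) 1 :=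
  ⟨ϖ, 1, h, by simp⟩

theorem HasOrder.inv (hf : HasOrder R f m) : HasOrder R f⁻¹ (-m) := by
  obtain ⟨ϖ, u, hϖ, rfl⟩ := hf
  have hu : ((u : R.toSubring) : RatFun) * ((u⁻¹ : (R.toSubring)ˣ) : R.toSubring) = 1 :=
    congrArg Subtype.val u.mul_inv
  exact ⟨ϖ, u⁻¹, hϖ, by rw [mul_inv, zpow_neg, eq_inv_of_mul_eq_one_right hu]⟩

theorem HasOrder.inv_notMem_of_pos (hf : HasOrder R f n) (hn : 0 < n) : f⁻¹ ∉ R.toSubring := by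
  have hf0 := hf.ne_zero
  obtain ⟨ϖ, u, hϖ, rfl⟩ := hf
  lift n to ℕ using hn.le
  intro hinv
  have hunit : IsUnit ((u : R.toSubring) * ϖ ^ n) := by
    refine isUnit_iff_ne_zero_and_inv_mem.2 ?_
    push_cast
    exact ⟨by exact_mod_cast hf0, by exact_mod_cast hinv⟩
  rw [IsUnit.mul_iff, isUnit_pow_iff (by lia)] at hunit
  exact hϖ.not_isUnit hunit.2

variable [IsDiscreteValuationRing R.toSubring]

theorem hasOrder_zero_iff : HasOrder R f 0 ↔ f ≠ 0 ∧ f ∈ R.toSubring ∧ f⁻¹ ∈ R.toSubring := by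
  constructor
  · intro h
    refine ⟨h.ne_zero, ?_⟩
    obtain ⟨ϖ, u, -, rfl⟩ := h
    simpa only [zpow_zero, mul_one] using
      And.intro (u : R.toSubring).2 (isUnit_iff_ne_zero_and_inv_mem.1 u.isUnit).2
  · rintro ⟨hf0, hf, hinv⟩
    obtain ⟨ϖ, hϖ⟩ := IsDiscreteValuationRing.exists_irreducible R.toSubring
    have hunit : IsUnit (⟨f, hf⟩ : R.toSubring) := isUnit_iff_ne_zero_and_inv_mem.2 ⟨hf0, hinv⟩
    exact ⟨ϖ, hunit.unit, hϖ, by simp⟩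

theorem hasOrder_zero_iff_notMem_vanishingSet (hf : f ∈ R.toSubring) :
    HasOrder R f 0 ↔ f ∉ vanishingSet R := by
  have zero_inv_mem : f = 0 → f⁻¹ ∈ R.toSubring := by rintro rfl; simp
  rw [hasOrder_zero_iff, mem_vanishingSet_iff]
  tauto

theorem hasOrder_iff {ϖ : R.toSubring} (hϖ : Irreducible ϖ) :
    HasOrder R f n ↔ ∃ u : (R.toSubring)ˣ, f = ((u : R.toSubring) : RatFun) * (ϖ : RatFun) ^ n := by
  refine ⟨?_, fun ⟨u, hu⟩ => ⟨ϖ, u, hϖ, hu⟩⟩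
  rintro ⟨ϖ', u, hϖ', rfl⟩
  obtain ⟨v, rfl⟩ := IsDiscreteValuationRing.associated_of_irreducible _ hϖ hϖ'
  have coe_zpow : (((v ^ n : (R.toSubring)ˣ) : R.toSubring) : RatFun) =
      ((v : R.toSubring) : RatFun) ^ n := by
    have := congrArg Units.val (map_zpow (Units.map (R.toSubring.subtype : _ →* RatFun)) v n)
    rwa [Units.val_zpow_eq_zpow_val] at this
  refine ⟨u * v ^ n, ?_⟩
  push_cast
  rw [coe_zpow, mul_zpow]
  ring

theorem HasOrder.mul (hf : HasOrder R f m) (hg : HasOrder R g n) : HasOrder R (f * g) (m + n) := by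
  obtain ⟨ϖ, u, hϖ, rfl⟩ := hf
  obtain ⟨v, rfl⟩ := (hasOrder_iff hϖ).1 hg
  refine ⟨ϖ, u * v, hϖ, ?_⟩
  rw [zpow_add₀ (ZeroMemClass.coe_eq_zero.not.2 hϖ.ne_zero)]
  push_cast
  ring

theorem HasOrder.div (hf : HasOrder R f m) (hg : HasOrder R g n) : HasOrder R (f / g) (m - n) := by
  simpa only [div_eq_mul_inv, sub_eq_add_neg] using hf.mul hg.inv

theorem hasOrder_one : HasOrder R 1 0 :=
  hasOrder_zero_iff.2 ⟨one_ne_zero, one_mem _, by simp⟩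

theorem HasOrder.sub_of_inv_mem_vanishingSet (hf : HasOrder R f n) (hinv : f⁻¹ ∈ vanishingSet R)
    (hg : g ∈ R.toSubring) : HasOrder R (f - g) n := by
  obtain ⟨hfR, hfm⟩ := hinv
  have isUnit : IsUnit (1 - ⟨f⁻¹, hfR⟩ * ⟨g, hg⟩ : R.toSubring) :=
    IsLocalRing.isUnit_one_sub_self_of_mem_nonunits _ (Ideal.mul_mem_right _ _ hfm)
  have hunit : HasOrder R (1 - f⁻¹ * g) 0 :=
    hasOrder_zero_iff.2 ⟨fun h => isUnit.ne_zero (Subtype.ext h),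
      sub_mem (one_mem _) (mul_mem hfR hg), (isUnit_iff_ne_zero_and_inv_mem.1 isUnit).2⟩
  have hmul := hf.mul hunit
  rwa [mul_sub, mul_one, mul_inv_cancel_left₀ hf.ne_zero, add_zero] at hmul

theorem HasOrder.zpow (hf : HasOrder R f m) (k : ℤ) : HasOrder R (f ^ k) (k * m) := by
  have pow (j : ℕ) : HasOrder R (f ^ j) (j * m) := by
    induction j with
    | zero => simpa using hasOrder_one
    | succ j ih => simpa [pow_succ, add_mul] using ih.mul hf
  obtain ⟨j, rfl | rfl⟩ := k.eq_nat_or_neg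
  · simpa using pow j
  · simpa using (pow j).inv

theorem HasOrder.prod {ι : Type*} (s : Finset ι) {f : ι → RatFun} {n : ι → ℤ}
    (h : ∀ i ∈ s, HasOrder R (f i) (n i)) : HasOrder R (∏ i ∈ s, f i) (∑ i ∈ s, n i) := by
  classical
  induction s using Finset.induction_on with
  | empty => simpa using hasOrder_one
  | insert i s hi ih =>
    rw [Finset.prod_insert hi, Finset.sum_insert hi]
    exact (h i (Finset.mem_insert_self _ _)).mul
      (ih fun j hj => h j (Finset.mem_insert_of_mem hj))

theorem HasOrder.unique (hf : HasOrder R f m) (hf' : HasOrder R f n) : m = n := by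
  have not_pos {k : ℤ} (h : HasOrder R 1 k) : ¬ 0 < k := fun hk =>
    h.inv_notMem_of_pos hk (by simp)
  have hsub := hf.div hf'
  have hsub' := hf'.div hf
  rw [div_self hf.ne_zero] at hsub hsub'
  have := not_pos hsub
  have := not_pos hsub'
  lia

end Order

theorem IsRegularModel.mem_of_hasOrder_zero {X : Model} (hX : IsRegularModel X)
    {q : LocalSubring RatFun} (hq : q ∈ X) {f : RatFun}
    (h : ∀ Z : PrimeDivisor X, q.toSubring ≤ Z.1.toSubring → HasOrder Z.1 f 0) :
    f ∈ q.toSubring := by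
  have hreg := hX.isRegularPoint q hq
  have := hreg.isNoetherianRing
  have := hreg.uniqueFactorizationMonoid
  have := hreg.isFractionRing
  refine mem_of_forall_isDiscreteValuationRing fun V hV hdvr => ?_
  exact (hasOrder_zero_iff.1 (h ⟨V, hX.mem_of_isLocalizationOf q hq V hV hdvr, hdvr⟩ hV.le)).2.1

/-- `D` is the divisor of the nonzero rational function `f`. -/
def IsDivisorOf {X : Model} (D : WeilDiv X) (f : RatFun) : Prop :=
  f ≠ 0 ∧ ∀ Z : PrimeDivisor X, HasOrder Z.1 f (D Z)

/-! ### The affine plane -/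

theorem height_eq_one_of_ringKrullDim_le_two {R : Type*} [CommRing R] [IsDomain R]
    (hdim : ringKrullDim R ≤ 2) {P : Ideal R} [P.IsPrime] (hbot : P ≠ ⊥) (hmax : ¬ P.IsMaximal) :
    P.height = 1 := by
  obtain ⟨M, hM, hPM⟩ := P.exists_le_maximal Ideal.IsPrime.ne_top'
  have := hM.isPrime
  have one_le : (⊥ : Ideal R).height + 1 ≤ P.height :=
    Ideal.height_add_one_le_of_lt_of_isPrime (bot_lt_iff_ne_bot.2 hbot)
  have add_one_le : P.height + 1 ≤ M.height :=
    Ideal.height_add_one_le_of_lt_of_isPrime (hPM.lt_of_ne fun h => hmax (h ▸ hM))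
  have le_two : M.height ≤ 2 := by
    have := (Ideal.height_le_ringKrullDim_of_isPrime (I := M)).trans hdim
    exact WithBot.coe_le_coe.1 this
  refine le_antisymm ?_ (by simpa using one_le)
  exact (ENat.add_le_add_iff_right ENat.one_ne_top).1 (add_one_le.trans le_two)

section Polynomials

open MvPolynomial

theorem vanishingIdeal_singleton_eq_span {k σ : Type*} [Field k] (x : σ → k) :
    (vanishingIdeal k {x} : Ideal (MvPolynomial σ k)) =
      Ideal.span (Set.range fun i => X i - C (x i)) := by
  set I := Ideal.span (Set.range fun i => X i - C (x i))
  refine le_antisymm (fun p hp => ?_) (Ideal.span_le.2 ?_)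
  · -- Modulo `I` every polynomial is congruent to its value at `x`.
    have mk_eq : Ideal.Quotient.mkₐ k I = (Algebra.ofId k _).comp (aeval x) := by
      refine algHom_ext fun i => ?_
      have : (X i - C (x i) : MvPolynomial σ k) ∈ I := Ideal.subset_span ⟨i, rfl⟩
      simpa [Algebra.ofId_apply, ← Ideal.Quotient.mk_algebraMap, algebraMap_eq] using
        Ideal.Quotient.eq.2 this
    rw [← Ideal.Quotient.eq_zero_iff_mem, ← Ideal.Quotient.mkₐ_eq_mk k, mk_eq, AlgHom.comp_apply,
      (mem_vanishingIdeal_singleton_iff x p).1 hp, map_zero]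
  · rintro _ ⟨i, rfl⟩
    simp

theorem exists_eq_span_pair_of_isPrime {k : Type*} [Field k] [IsAlgClosed k]
    (P : Ideal (MvPolynomial (Fin 2) k)) [P.IsPrime] : ∃ a b, P = Ideal.span {a, b} := by
  by_cases hmax : P.IsMaximal
  · obtain ⟨x, rfl⟩ := isMaximal_iff_eq_vanishingIdeal_singleton.1 hmax
    refine ⟨X 0 - C (x 0), X 1 - C (x 1), ?_⟩
    rw [vanishingIdeal_singleton_eq_span]
    congr 1
    ext p
    simp [Fin.exists_fin_two, eq_comm]
  by_cases hbot : P = ⊥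
  · exact ⟨0, 0, by simp [hbot]⟩
  have hdim : ringKrullDim (MvPolynomial (Fin 2) k) ≤ 2 := by
    simp [MvPolynomial.ringKrullDim_of_isNoetherianRing]
  obtain ⟨π, hπ⟩ := UniqueFactorizationMonoid.isPrincipal_of_height_eq_one
    (height_eq_one_of_ringKrullDim_le_two hdim hbot hmax)
  exact ⟨π, π, by rw [Set.pair_eq_singleton]; exact hπ⟩

theorem prime_X_zero_sub_C {R : Type*} [CommRing R] [IsDomain R] {n : ℕ} (a : R) :
    Prime (X 0 - C a : MvPolynomial (Fin (n + 1)) R) := by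
  rw [← MulEquiv.prime_iff (finSuccEquiv R n), map_sub, finSuccEquiv_X_zero, finSuccEquiv_apply,
    eval₂Hom_C]
  exact Polynomial.prime_X_sub_C _

end Polynomials

/-- The coordinate ring `ℂ[u, v]` of the affine chart with coordinates `u` and `v`. -/
def coordRing (u v : RatFun) : Subring RatFun := (Algebra.adjoin ℂ {u, v}).toSubring

theorem coordRing_comm (u v : RatFun) : coordRing u v = coordRing v u := by
  rw [coordRing, coordRing, Set.pair_comm]

theorem mem_coordRing_iff {u v f : RatFun} :
    f ∈ coordRing u v ↔ ∃ p : MvPolynomial (Fin 2) ℂ, MvPolynomial.aeval ![u, v] p = f := by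
  change f ∈ Algebra.adjoin ℂ {u, v} ↔ _
  rw [← Matrix.range_cons_cons_empty u v ![], Algebra.adjoin_range_eq_range_aeval]
  rfl

theorem fst_mem_coordRing (u v : RatFun) : u ∈ coordRing u v :=
  Algebra.subset_adjoin (by simp)

theorem snd_mem_coordRing (u v : RatFun) : v ∈ coordRing u v :=
  Algebra.subset_adjoin (by simp)

theorem algebraMap_mem_coordRing (u v : RatFun) (c : ℂ) : algebraMap ℂ RatFun c ∈ coordRing u v :=
  (Algebra.adjoin ℂ {u, v}).algebraMap_mem c

theorem coordRing_le {u v : RatFun} {T : Subring RatFun}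
    (hc : ∀ c, algebraMap ℂ RatFun c ∈ T) (hu : u ∈ T) (hv : v ∈ T) : coordRing u v ≤ T :=
  Algebra.adjoin_le (S := { T with algebraMap_mem' := hc }) (Set.pair_subset hu hv)

/-- The line `u = a` in the affine chart with coordinates `u` and `v`. -/
def line (u v : RatFun) (a : ℂ) : coordRing u v :=
  ⟨u - algebraMap ℂ RatFun a, sub_mem (fst_mem_coordRing u v) (algebraMap_mem_coordRing u v a)⟩

/-- `u` and `v` are the coordinates of an affine chart of a surface with function field `ℂ(x, y)`:
they generate this field. -/
def IsCoordPair (u v : RatFun) : Prop := IntermediateField.adjoin ℂ {u, v} = ⊤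

namespace IsCoordPair

variable {u v : RatFun}

theorem swap (h : IsCoordPair u v) : IsCoordPair v u := by
  rwa [IsCoordPair, Set.pair_comm]

theorem inv_fst (h : IsCoordPair u v) : IsCoordPair u⁻¹ v := by
  rw [IsCoordPair, eq_top_iff, ← show _ = ⊤ from h, IntermediateField.adjoin_le_iff]
  refine Set.pair_subset ?_ (IntermediateField.subset_adjoin _ _ (by simp))
  simpa using inv_mem (IntermediateField.subset_adjoin ℂ {u⁻¹, v} (Set.mem_insert _ _))

theorem isFractionRing (h : IsCoordPair u v) : IsFractionRing (coordRing u v) RatFun := by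
  refine IsFractionRing.of_field _ _ fun f => ?_
  obtain ⟨r, hr, s, hs, rfl⟩ := IntermediateField.mem_adjoin_iff_div.1
    (h.symm ▸ IntermediateField.mem_top : f ∈ IntermediateField.adjoin ℂ {u, v})
  exact ⟨⟨r, hr⟩, ⟨s, hs⟩, rfl⟩

theorem algebraicIndependent (h : IsCoordPair u v) : AlgebraicIndependent ℂ ![u, v] := by
  have isAlgebraic : Algebra.IsAlgebraic (Algebra.adjoin ℂ (Set.range ![u, v])) RatFun := by
    rw [Matrix.range_cons_cons_empty]
    have : IsFractionRing (Algebra.adjoin ℂ {u, v}) RatFun := h.isFractionRing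
    exact IsLocalization.isAlgebraic _ (nonZeroDivisors (Algebra.adjoin ℂ {u, v}))
  have two_le_trdeg : Cardinal.mk (Fin 2) ≤ Algebra.trdeg ℂ RatFun := by
    simpa using trdeg_le_of_injective
      (IsScalarTower.toAlgHom ℂ (MvPolynomial (Fin 2) ℂ) RatFun)
      (IsFractionRing.injective (MvPolynomial (Fin 2) ℂ) RatFun)
  exact (Algebra.IsAlgebraic.isTranscendenceBasis_of_le_trdeg_of_finite ℂ _ two_le_trdeg).1

theorem exists_ringEquiv (h : IsCoordPair u v) : ∃ e : MvPolynomial (Fin 2) ℂ ≃+* coordRing u v,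
    ∀ p, (e p : RatFun) = MvPolynomial.aeval ![u, v] p := by
  have hadjoin : Algebra.adjoin ℂ (Set.range ![u, v]) = Algebra.adjoin ℂ {u, v} := by
    rw [Matrix.range_cons_cons_empty]
  exact ⟨(h.algebraicIndependent.aevalEquiv.trans (Subalgebra.equivOfEq _ _ hadjoin)).toRingEquiv,
    fun _ => rfl⟩

theorem isNoetherianRing (h : IsCoordPair u v) : IsNoetherianRing (coordRing u v) := by
  obtain ⟨e, -⟩ := h.exists_ringEquiv
  exact isNoetherianRing_of_ringEquiv _ e

theorem uniqueFactorizationMonoid (h : IsCoordPair u v) :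
    UniqueFactorizationMonoid (coordRing u v) := by
  obtain ⟨e, -⟩ := h.exists_ringEquiv
  exact e.toMulEquiv.uniqueFactorizationMonoid inferInstance

theorem exists_eq_span_pair (h : IsCoordPair u v) (P : Ideal (coordRing u v)) [P.IsPrime] :
    ∃ a b, P = Ideal.span {a, b} := by
  obtain ⟨e, -⟩ := h.exists_ringEquiv
  obtain ⟨a, b, hab⟩ := exists_eq_span_pair_of_isPrime (P.comap e)
  refine ⟨e a, e b, ?_⟩
  rw [← Ideal.map_comap_of_surjective e e.surjective P, hab, Ideal.map_span, Set.image_pair]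

theorem isRegularPoint (h : IsCoordPair u v) {V : LocalSubring RatFun}
    (hV : IsLocalizationOf V (coordRing u v)) : IsRegularPoint V := by
  have := h.isFractionRing
  have := h.isNoetherianRing
  have := h.uniqueFactorizationMonoid
  exact hV.isRegularPoint_of_uniqueFactorizationMonoid (h.exists_eq_span_pair _)

theorem prime_line (h : IsCoordPair u v) (a : ℂ) : Prime (line u v a) := by
  obtain ⟨e, he⟩ := h.exists_ringEquiv
  have : e (MvPolynomial.X 0 - MvPolynomial.C a) = line u v a :=
    Subtype.ext ((he _).trans (by simp [line]))
  rw [← this, MulEquiv.prime_iff]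
  exact prime_X_zero_sub_C a

theorem not_line_dvd_snd (h : IsCoordPair u v) (a : ℂ) :
    ¬ line u v a ∣ ⟨v, snd_mem_coordRing u v⟩ := by
  rintro ⟨⟨_, hg⟩, hv⟩
  obtain ⟨p, rfl⟩ := mem_coordRing_iff.1 hg
  have hdvd : MvPolynomial.X 1 = (MvPolynomial.X 0 - MvPolynomial.C a) * p :=
    h.algebraicIndependent (by simpa [line] using congrArg Subtype.val hv)
  simpa using congrArg (MvPolynomial.eval ![a, 1]) hdvd

end IsCoordPair

/-! ### The surface `ℙ¹ × ℙ¹` -/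

theorem coordinate_mem_of_le {q V : LocalSubring RatFun} (h : q ≤ V) {c u u' : RatFun}
    (hu : u ∈ ({c, c⁻¹} : Set RatFun)) (hu' : u' ∈ ({c, c⁻¹} : Set RatFun))
    (huq : u ∈ q.toSubring) (hu'V : u' ∈ V.toSubring) : u' ∈ q.toSubring := by
  rcases hu with rfl | rfl <;> rcases hu' with rfl | rfl
  · exact huq
  · exact inv_mem_of_le h huq hu'V
  · simpa using inv_mem_of_le h huq (by simpa using hu'V)
  · exact huq

/-- `c` and `d` are affine coordinates on the two factors of `ℙ¹ × ℙ¹`, in either order. -/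
structure IsProductCoordinates (c d : RatFun) : Prop where
  isCoordPair : IsCoordPair c d
  mem_P1P1_iff {R : LocalSubring RatFun} : R ∈ P1P1 ↔ ∃ u ∈ ({c, c⁻¹} : Set RatFun),
    ∃ v ∈ ({d, d⁻¹} : Set RatFun), IsLocalizationOf R (coordRing u v)

theorem polyFun_eq_aeval (p : MvPolynomial (Fin 2) ℂ) :
    polyFun p = MvPolynomial.aeval ![xFun, yFun] p := by
  have : IsScalarTower.toAlgHom ℂ (MvPolynomial (Fin 2) ℂ) RatFun =
      MvPolynomial.aeval ![xFun, yFun] := by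
    refine MvPolynomial.algHom_ext fun i => ?_
    fin_cases i <;> simp [xFun, yFun, polyFun]
  exact DFunLike.congr_fun this p

theorem isProductCoordinates_xFun_yFun : IsProductCoordinates xFun yFun := by
  refine ⟨eq_top_iff.2 fun f _ => ?_, Iff.rfl⟩
  have polyFun_mem (p : MvPolynomial (Fin 2) ℂ) :
      polyFun p ∈ IntermediateField.adjoin ℂ {xFun, yFun} :=
    IntermediateField.algebra_adjoin_le_adjoin _ _
      (mem_coordRing_iff.2 ⟨p, (polyFun_eq_aeval p).symm⟩)
  obtain ⟨p, q, -, rfl⟩ := IsFractionRing.div_surjective (A := MvPolynomial (Fin 2) ℂ) f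
  exact div_mem (polyFun_mem p) (polyFun_mem q)

theorem algebraMap_mem_of_mem_P1P1 {R : LocalSubring RatFun} (hR : R ∈ P1P1) (a : ℂ) :
    algebraMap ℂ RatFun a ∈ R.toSubring := by
  obtain ⟨u, -, v, -, h⟩ := isProductCoordinates_xFun_yFun.mem_P1P1_iff.1 hR
  exact h.le (algebraMap_mem_coordRing u v a)

namespace IsProductCoordinates

variable {c d : RatFun}

theorem swap (h : IsProductCoordinates c d) : IsProductCoordinates d c := by
  refine ⟨h.isCoordPair.swap, h.mem_P1P1_iff.trans ⟨?_, ?_⟩⟩ <;>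
  · rintro ⟨u, hu, v, hv, hR⟩
    exact ⟨v, hv, u, hu, coordRing_comm u v ▸ hR⟩

theorem inv_fst (h : IsProductCoordinates c d) : IsProductCoordinates c⁻¹ d :=
  ⟨h.isCoordPair.inv_fst, by rw [inv_inv, Set.pair_comm]; exact h.mem_P1P1_iff⟩

theorem inv_snd (h : IsProductCoordinates c d) : IsProductCoordinates c d⁻¹ :=
  h.swap.inv_fst.swap

theorem isCoordPair_of_mem (h : IsProductCoordinates c d) {u v : RatFun}
    (hu : u ∈ ({c, c⁻¹} : Set RatFun)) (hv : v ∈ ({d, d⁻¹} : Set RatFun)) : IsCoordPair u v := by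
  rcases hu with rfl | rfl <;> rcases hv with rfl | rfl
  exacts [h.isCoordPair, h.inv_snd.isCoordPair, h.inv_fst.isCoordPair,
    h.inv_fst.inv_snd.isCoordPair]

theorem fst_ne_zero (h : IsProductCoordinates c d) : c ≠ 0 := by
  simpa [line] using (h.isCoordPair.prime_line 0).ne_zero ∘ Subtype.ext

end IsProductCoordinates

theorem isRegularModel_P1P1 : IsRegularModel P1P1 := by
  have h := isProductCoordinates_xFun_yFun
  refine ⟨fun q hq => ?_, fun q₁ hq₁ q₂ hq₂ V h₁ h₂ => ?_, fun q hq V hV _ => ?_⟩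
  · obtain ⟨u, hu, v, hv, hloc⟩ := h.mem_P1P1_iff.1 hq
    exact (h.isCoordPair_of_mem hu hv).isRegularPoint hloc
  · obtain ⟨u₁, hu₁, v₁, hv₁, hloc₁⟩ := h.mem_P1P1_iff.1 hq₁
    obtain ⟨u₂, hu₂, v₂, hv₂, hloc₂⟩ := h.mem_P1P1_iff.1 hq₂
    have fst_mem₁ := hloc₁.le (fst_mem_coordRing u₁ v₁)
    have snd_mem₁ := hloc₁.le (snd_mem_coordRing u₁ v₁)
    have fst_mem₂ := hloc₂.le (fst_mem_coordRing u₂ v₂)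
    have snd_mem₂ := hloc₂.le (snd_mem_coordRing u₂ v₂)
    refine hloc₁.eq_of_le hloc₂ h₁ h₂ ?_ ?_
    · exact coordRing_le (algebraMap_mem_of_mem_P1P1 hq₂)
        (coordinate_mem_of_le h₂ hu₂ hu₁ fst_mem₂ (h₁.1 fst_mem₁))
        (coordinate_mem_of_le h₂ hv₂ hv₁ snd_mem₂ (h₁.1 snd_mem₁))
    · exact coordRing_le (algebraMap_mem_of_mem_P1P1 hq₁)
        (coordinate_mem_of_le h₁ hu₁ hu₂ fst_mem₁ (h₂.1 fst_mem₂))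
        (coordinate_mem_of_le h₁ hv₁ hv₂ snd_mem₁ (h₂.1 snd_mem₂))
  · obtain ⟨u, hu, v, hv, hloc⟩ := h.mem_P1P1_iff.1 hq
    exact h.mem_P1P1_iff.2 ⟨u, hu, v, hv, hV.trans hloc⟩

namespace IsBlownUpSurface

variable {X : Model}

theorem isRegularModel (hX : IsBlownUpSurface X) : IsRegularModel X := by
  induction hX with
  | base => exact isRegularModel_P1P1
  | step X p _ hp _ ih => exact ih.blowup hp

theorem mem_of_mem_P1P1 (hX : IsBlownUpSurface X) {V : LocalSubring RatFun} (hV : V ∈ P1P1)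
    [IsDiscreteValuationRing V.toSubring] : V ∈ X := by
  induction hX with
  | base => exact hV
  | step X p _ _ _ ih => exact mem_blowup_of_isDiscreteValuationRing ih

end IsBlownUpSurface

/-! ### Coordinate lines -/

namespace IsCoordPair

variable {c d : RatFun} {a : ℂ} {Z : LocalSubring RatFun} [IsDiscreteValuationRing Z.toSubring]

theorem center_eq_span_line (h : IsCoordPair c d) (hZ : IsLocalizationOf Z (coordRing c d))
    (ha : c - algebraMap ℂ RatFun a ∈ vanishingSet Z) :
    center (coordRing c d) Z hZ.le = Ideal.span {line c d a} := by
  obtain ⟨_, hmem⟩ := ha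
  exact hZ.center_eq_span (h.prime_line a) hmem

theorem inv_snd_mem (h : IsCoordPair c d) (hZ : IsLocalizationOf Z (coordRing c d))
    (ha : c - algebraMap ℂ RatFun a ∈ vanishingSet Z) : d⁻¹ ∈ Z.toSubring := by
  have notMem : (⟨d, snd_mem_coordRing c d⟩ : coordRing c d) ∉ center (coordRing c d) Z hZ.le := by
    rw [h.center_eq_span_line hZ ha, Ideal.mem_span_singleton]
    exact h.not_line_dvd_snd a
  rw [mem_center_iff_inv_mem] at notMem
  push Not at notMem
  exact notMem.1

end IsCoordPair

namespace IsProductCoordinates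

variable {c d : RatFun} {a : ℂ} {Z W : PrimeDivisor P1P1}

theorem fst_mem_or_inv_mem (h : IsProductCoordinates c d) {R : LocalSubring RatFun}
    (hR : R ∈ P1P1) : c ∈ R.toSubring ∨ c⁻¹ ∈ R.toSubring := by
  obtain ⟨u, rfl | rfl, v, -, hloc⟩ := h.mem_P1P1_iff.1 hR
  exacts [.inl (hloc.le (fst_mem_coordRing _ v)), .inr (hloc.le (fst_mem_coordRing _ v))]

theorem isLocalizationOf (h : IsProductCoordinates c d) {R : LocalSubring RatFun} (hR : R ∈ P1P1)
    (hc : c ∈ R.toSubring) (hd : d ∈ R.toSubring) : IsLocalizationOf R (coordRing c d) := by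
  have hle : coordRing c d ≤ R.toSubring := coordRing_le (algebraMap_mem_of_mem_P1P1 hR) hc hd
  have hloc := isLocalizationOf_ofPrime (coordRing c d) (center _ R hle)
  have hmem := h.mem_P1P1_iff.2 ⟨c, by simp, d, by simp, hloc⟩
  rwa [isRegularModel_P1P1.eq_of_le _ hmem R hR R (ofPrime_center_le hle) le_rfl] at hloc

theorem isLocalizationOf_of_sub_mem (h : IsProductCoordinates c d)
    (hZ : c - algebraMap ℂ RatFun a ∈ vanishingSet Z.1) :
    IsLocalizationOf Z.1 (coordRing c d) := by
  have := Z.2.2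
  have hc : c ∈ Z.1.toSubring := by
    simpa using add_mem hZ.1 (algebraMap_mem_of_mem_P1P1 Z.2.1 a)
  have hd : d ∈ Z.1.toSubring := (h.swap.fst_mem_or_inv_mem Z.2.1).elim id fun hd => by
    simpa using h.inv_snd.isCoordPair.inv_snd_mem (h.inv_snd.isLocalizationOf Z.2.1 hc hd) hZ
  exact h.isLocalizationOf Z.2.1 hc hd

theorem eq_of_sub_mem (h : IsProductCoordinates c d)
    (hZ : c - algebraMap ℂ RatFun a ∈ vanishingSet Z.1)
    (hW : c - algebraMap ℂ RatFun a ∈ vanishingSet W.1) : Z = W := by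
  have := Z.2.2
  have := W.2.2
  have locZ := h.isLocalizationOf_of_sub_mem hZ
  have locW := h.isLocalizationOf_of_sub_mem hW
  exact Subtype.ext (locZ.eq_of_center_eq locW ((h.isCoordPair.center_eq_span_line locZ hZ).trans
    (h.isCoordPair.center_eq_span_line locW hW).symm))

theorem hasOrder_sub_one (h : IsProductCoordinates c d)
    (hZ : c - algebraMap ℂ RatFun a ∈ vanishingSet Z.1) :
    HasOrder Z.1 (c - algebraMap ℂ RatFun a) 1 := by
  have := Z.2.2
  have hloc := h.isLocalizationOf_of_sub_mem hZ
  exact hasOrder_one_of_irreducible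
    (hloc.irreducible_inclusion (h.isCoordPair.center_eq_span_line hloc hZ))

end IsProductCoordinates

theorem linForm_infty (c : RatFun) : linForm OnePoint.infty c = 1 := rfl

theorem linForm_coe (c : RatFun) (b : ℂ) :
    linForm (b : OnePoint ℂ) c = c - algebraMap ℂ RatFun b := rfl

theorem hasValue_infty_iff {R : LocalSubring RatFun} {c : RatFun} :
    HasValue R c OnePoint.infty ↔ c⁻¹ - algebraMap ℂ RatFun 0 ∈ vanishingSet R := by
  rw [map_zero, sub_zero]
  rfl

namespace IsProductCoordinates

variable {c d : RatFun} {a : OnePoint ℂ} {Z W : PrimeDivisor P1P1}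

theorem eq_of_hasValue (h : IsProductCoordinates c d) (hZ : HasValue Z.1 c a)
    (hW : HasValue W.1 c a) : Z = W := by
  induction a using OnePoint.rec with
  | infty =>
    rw [hasValue_infty_iff] at hZ hW
    exact h.inv_fst.eq_of_sub_mem hZ hW
  | coe b => exact h.eq_of_sub_mem hZ hW

theorem fst_mem_iff_not_hasValue_infty (h : IsProductCoordinates c d) :
    c ∈ Z.1.toSubring ↔ ¬ HasValue Z.1 c OnePoint.infty := by
  have := h.fst_mem_or_inv_mem Z.2.1
  have := h.fst_ne_zero
  rw [hasValue_infty_iff, map_zero, sub_zero, mem_vanishingSet_iff, inv_inv, inv_eq_zero]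
  tauto

theorem hasOrder_linForm_of_mem (h : IsProductCoordinates c d) (hW : HasValue W.1 c a)
    (hc : c ∈ Z.1.toSubring) :
    HasOrder Z.1 (linForm a c) ((Finsupp.single W 1 : WeilDiv P1P1) Z) := by
  have := Z.2.2
  have ne_of_not_hasValue (hZ : ¬ HasValue Z.1 c a) : W ≠ Z := by rintro rfl; exact hZ hW
  induction a using OnePoint.rec with
  | infty =>
    rw [linForm_infty, Finsupp.single_eq_of_ne'
      (ne_of_not_hasValue (h.fst_mem_iff_not_hasValue_infty.1 hc))]
    exact hasOrder_one
  | coe b =>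
    rw [linForm_coe]
    by_cases hZ : HasValue Z.1 c b
    · rw [h.eq_of_hasValue hW hZ, Finsupp.single_eq_same]
      exact h.hasOrder_sub_one hZ
    · rw [Finsupp.single_eq_of_ne' (ne_of_not_hasValue hZ), hasOrder_zero_iff_notMem_vanishingSet
        (sub_mem hc (algebraMap_mem_of_mem_P1P1 Z.2.1 b))]
      exact hZ

theorem hasOrder_linForm_of_notMem (h : IsProductCoordinates c d) (hW : HasValue W.1 c a)
    (hc : c ∉ Z.1.toSubring) :
    HasOrder Z.1 (linForm a c) ((Finsupp.single W 1 : WeilDiv P1P1) Z - 1) := by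
  have := Z.2.2
  have hZ : HasValue Z.1 c OnePoint.infty := not_not.1 (h.fst_mem_iff_not_hasValue_infty.not.1 hc)
  induction a using OnePoint.rec with
  | infty =>
    rw [linForm_infty, h.eq_of_hasValue hW hZ, Finsupp.single_eq_same, sub_self]
    exact hasOrder_one
  | coe b =>
    have hne : W ≠ Z := by
      rintro rfl
      exact hc (by simpa using add_mem hW.1 (algebraMap_mem_of_mem_P1P1 W.2.1 b))
    have hasOrder_fst : HasOrder Z.1 c (-1) := by
      simpa using (h.inv_fst.hasOrder_sub_one (hasValue_infty_iff.1 hZ)).inv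
    rw [linForm_coe, Finsupp.single_eq_of_ne' hne, zero_sub]
    exact hasOrder_fst.sub_of_inv_mem_vanishingSet hZ (algebraMap_mem_of_mem_P1P1 Z.2.1 b)

theorem isDivisorOf_linForm_div (h : IsProductCoordinates c d) {a₁ a₂ : OnePoint ℂ}
    {W₁ W₂ : PrimeDivisor P1P1} (h₁ : HasValue W₁.1 c a₁) (h₂ : HasValue W₂.1 c a₂) :
    IsDivisorOf (Finsupp.single W₁ 1 - Finsupp.single W₂ 1 : WeilDiv P1P1)
      (linForm a₁ c / linForm a₂ c) := by
  suffices hord : ∀ Z : PrimeDivisor P1P1, HasOrder Z.1 (linForm a₁ c / linForm a₂ c)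
      ((Finsupp.single W₁ 1 - Finsupp.single W₂ 1 : WeilDiv P1P1) Z) from
    ⟨(hord W₁).ne_zero, hord⟩
  intro Z
  have := Z.2.2
  rw [Finsupp.sub_apply]
  by_cases hc : c ∈ Z.1.toSubring
  · exact (h.hasOrder_linForm_of_mem h₁ hc).div (h.hasOrder_linForm_of_mem h₂ hc)
  · simpa only [sub_sub_sub_cancel_right] using
      (h.hasOrder_linForm_of_notMem h₁ hc).div (h.hasOrder_linForm_of_notMem h₂ hc)

end IsProductCoordinates

/-! ### Pull-backs of divisors -/

/-- The preimage of a local subring under a homomorphism of fields. For the comorphism of a rational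
map it dominates every image of the point, so that on a separated model there is at most one. -/
def comapLocalSubring {K L : Type*} [Field K] [Field L] (φ : K →+* L) (R : LocalSubring L) :
    LocalSubring K where
  toSubring := R.toSubring.comap φ
  isLocalRing := by
    let f : R.toSubring.comap φ →+* R.toSubring :=
      (φ.comp (R.toSubring.comap φ).subtype).codRestrict R.toSubring fun a => a.2
    have : IsLocalHom f := by
      refine ⟨fun a ha => ?_⟩
      obtain ⟨hne, hinv⟩ := isUnit_iff_ne_zero_and_inv_mem.1 ha
      refine isUnit_iff_ne_zero_and_inv_mem.2 ⟨ne_zero_of_map (f := φ) hne, ?_⟩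
      exact Subring.mem_comap.2 ((map_inv₀ φ (a : K)).symm ▸ hinv)
    exact f.domain_isLocalRing

section Pullback

variable {φ : RatFun →ₐ[ℂ] RatFun} {R q : LocalSubring RatFun} {X Y : Model}

theorem MapsTo.mem (h : MapsTo φ R q) {a : RatFun} (ha : a ∈ q.toSubring) : φ a ∈ R.toSubring :=
  h.1 ⟨a, ha, rfl⟩

theorem MapsTo.le_comapLocalSubring (h : MapsTo φ R q) :
    q ≤ comapLocalSubring (φ : RatFun →+* RatFun) R := by
  refine localSubring_le_iff_inv_mem.2 ⟨fun a ha => h.mem ha, fun a ha hinv => ?_⟩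
  obtain ⟨b, hb, hba⟩ : (φ a)⁻¹ ∈ (q.map (φ : RatFun →+* RatFun)).toSubring :=
    inv_mem_of_le h ⟨a, ha, rfl⟩ (map_inv₀ φ a ▸ hinv)
  have hb_eq : b = a⁻¹ := φ.injective (hba.trans (map_inv₀ φ a).symm)
  exact hb_eq ▸ hb

theorem IsRegularModel.eq_of_mapsTo (hY : IsRegularModel Y) {q₁ q₂ : LocalSubring RatFun}
    (h₁ : q₁ ∈ Y) (h₂ : q₂ ∈ Y) (hm₁ : MapsTo φ R q₁) (hm₂ : MapsTo φ R q₂) : q₁ = q₂ :=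
  hY.eq_of_le _ h₁ _ h₂ _ hm₁.le_comapLocalSubring hm₂.le_comapLocalSubring

namespace IsLocalEquation

variable {D D₁ D₂ : WeilDiv Y} {g g₁ g₂ : RatFun}

theorem mul (h₁ : IsLocalEquation D₁ q g₁) (h₂ : IsLocalEquation D₂ q g₂) :
    IsLocalEquation (D₁ + D₂) q (g₁ * g₂) := by
  refine ⟨mul_ne_zero h₁.1 h₂.1, fun Z hZ => ?_⟩
  have := Z.2.2
  exact (h₁.2 Z hZ).mul (h₂.2 Z hZ)

theorem zpow (h : IsLocalEquation D q g) (n : ℤ) : IsLocalEquation (n • D) q (g ^ n) := by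
  refine ⟨zpow_ne_zero n h.1, fun Z hZ => ?_⟩
  have := Z.2.2
  exact (h.2 Z hZ).zpow n

theorem div_mem (h₁ : IsLocalEquation D q g₁) (h₂ : IsLocalEquation D q g₂)
    (hY : IsRegularModel Y) (hq : q ∈ Y) : g₁ / g₂ ∈ q.toSubring := by
  refine hY.mem_of_hasOrder_zero hq fun Z hZ => ?_
  have := Z.2.2
  simpa using (h₁.2 Z hZ).div (h₂.2 Z hZ)

end IsLocalEquation

namespace IsPullback

theorem add {D₁ D₂ : WeilDiv Y} {E₁ E₂ : WeilDiv X} (hY : IsRegularModel Y)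
    (h₁ : IsPullback φ D₁ E₁) (h₂ : IsPullback φ D₂ E₂) :
    IsPullback φ (D₁ + D₂) (E₁ + E₂) := fun R => by
  obtain ⟨q, hq, hm, g₁, hg₁, ho₁⟩ := h₁ R
  obtain ⟨q', hq', hm', g₂, hg₂, ho₂⟩ := h₂ R
  obtain rfl := hY.eq_of_mapsTo hq hq' hm hm'
  have := R.2.2
  exact ⟨q, hq, hm, g₁ * g₂, hg₁.mul hg₂, map_mul φ g₁ g₂ ▸ ho₁.mul ho₂⟩

theorem zsmul {D : WeilDiv Y} {E : WeilDiv X} (h : IsPullback φ D E) (n : ℤ) :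
    IsPullback φ (n • D) (n • E) := fun R => by
  obtain ⟨q, hq, hm, g, hg, ho⟩ := h R
  have := R.2.2
  exact ⟨q, hq, hm, g ^ n, hg.zpow n, map_zpow₀ φ g n ▸ ho.zpow n⟩

theorem sub {D₁ D₂ : WeilDiv Y} {E₁ E₂ : WeilDiv X} (hY : IsRegularModel Y)
    (h₁ : IsPullback φ D₁ E₁) (h₂ : IsPullback φ D₂ E₂) :
    IsPullback φ (D₁ - D₂) (E₁ - E₂) := by
  simpa only [neg_smul, one_smul, ← sub_eq_add_neg] using h₁.add hY (h₂.zsmul (-1))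

/- The empty sum is excluded because `IsPullback φ 0 0` asserts that the map is defined at the
generic points of all curves. -/
theorem sum {ι : Type*} {s : Finset ι} (hs : s.Nonempty) {D : ι → WeilDiv Y} {E : ι → WeilDiv X}
    (hY : IsRegularModel Y) (h : ∀ i ∈ s, IsPullback φ (D i) (E i)) :
    IsPullback φ (∑ i ∈ s, D i) (∑ i ∈ s, E i) := by
  induction hs using Finset.Nonempty.cons_induction with
  | singleton i => simpa using h i (Finset.mem_singleton_self i)
  | cons i s hi _ ih =>
    rw [Finset.sum_cons, Finset.sum_cons]
    exact (h i (Finset.mem_cons_self i s)).add hY (ih fun j hj => h j (Finset.mem_cons_of_mem hj))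

theorem of_forall_mem_support {D : WeilDiv Y} (hD : D ≠ 0) {B : PrimeDivisor Y → WeilDiv X}
    (hY : IsRegularModel Y) (h : ∀ Z ∈ D.support, IsPullback φ (Finsupp.single Z 1) (B Z)) :
    IsPullback φ D (D.sum fun Z n => n • B Z) := by
  have hsum := sum (Finsupp.support_nonempty_iff.2 hD) hY fun Z hZ => (h Z hZ).zsmul (D Z)
  simp only [Finsupp.smul_single, smul_eq_mul, mul_one] at hsum
  rwa [← Finsupp.sum, Finsupp.sum_single] at hsum

end IsPullback

theorem IsDivisorOf.map {D : WeilDiv Y} {E : WeilDiv X} {f : RatFun} (hD : IsDivisorOf D f)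
    (hY : IsRegularModel Y) (h : IsPullback φ D E) : IsDivisorOf E (φ f) := by
  refine ⟨(map_ne_zero φ).2 hD.1, fun R => ?_⟩
  obtain ⟨q, hq, hm, g, hg, ho⟩ := h R
  have := R.2.2
  have hf : IsLocalEquation D q f := ⟨hD.1, fun Z _ => hD.2 Z⟩
  have hunit : HasOrder R.1 (φ (f / g)) 0 := by
    refine hasOrder_zero_iff.2 ⟨(map_ne_zero φ).2 (div_ne_zero hf.1 hg.1),
      hm.mem (hf.div_mem hg hY hq), ?_⟩
    rw [← map_inv₀, inv_div]
    exact hm.mem (hg.div_mem hf hY hq)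
  have hmul := hunit.mul ho
  rwa [← map_mul, div_mul_cancel₀ _ hg.1, zero_add] at hmul

/- The coefficient of the pull-back at the strict transform of the curve is one. -/
theorem IsPullback.ne_zero_of_single (hX : IsBlownUpSurface X) {W : PrimeDivisor P1P1}
    {A : WeilDiv X} (hA : IsPullback (AlgHom.id ℂ RatFun) (Finsupp.single W 1) A) : A ≠ 0 := by
  rintro rfl
  have := W.2.2
  obtain ⟨q, -, hm, g, hg, ho⟩ := hA ⟨W.1, hX.mem_of_mem_P1P1 W.2.1, W.2.2⟩
  have hone := hg.2 W fun a ha => hm.mem ha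
  rw [Finsupp.single_eq_same] at hone
  exact one_ne_zero (hone.unique ho)

end Pullback

/-! ### Defining polynomials -/

/-- The identification of `ℂ[x, y]` with the coordinate ring of the affine chart `(x, y)`. -/
def polyEquiv : MvPolynomial (Fin 2) ℂ ≃+* coordRing xFun yFun :=
  isProductCoordinates_xFun_yFun.isCoordPair.exists_ringEquiv.choose

theorem coe_polyEquiv (p : MvPolynomial (Fin 2) ℂ) : (polyEquiv p : RatFun) = polyFun p := by
  rw [polyFun_eq_aeval]
  exact isProductCoordinates_xFun_yFun.isCoordPair.exists_ringEquiv.choose_spec p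

theorem mem_P1P1_of_isLocalizationOf {V : LocalSubring RatFun}
    (hV : IsLocalizationOf V (coordRing xFun yFun)) : V ∈ P1P1 :=
  isProductCoordinates_xFun_yFun.mem_P1P1_iff.2 ⟨xFun, by simp, yFun, by simp, hV⟩

section Curve

variable {V Z : LocalSubring RatFun} {p : MvPolynomial (Fin 2) ℂ}

theorem polyEquiv_mem_center_iff (hV : IsLocalizationOf V (coordRing xFun yFun)) :
    polyEquiv p ∈ center _ V hV.le ↔ polyFun p ∈ vanishingSet V := by
  rw [mem_center_iff_inv_mem, mem_vanishingSet_iff, ← coe_polyEquiv,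
    and_iff_right (hV.le (polyEquiv p).2)]

theorem center_eq_span_polyEquiv (hZ : IsLocalizationOf Z (coordRing xFun yFun))
    (hp : ∀ a, polyFun a ∈ vanishingSet Z ↔ p ∣ a) :
    center _ Z hZ.le = Ideal.span {polyEquiv p} := by
  ext b
  obtain ⟨a, rfl⟩ := polyEquiv.surjective b
  rw [polyEquiv_mem_center_iff hZ, hp, Ideal.mem_span_singleton, map_dvd_iff]

theorem hasOrder_polyFun_one [IsDiscreteValuationRing Z.toSubring]
    (hZ : IsLocalizationOf Z (coordRing xFun yFun))
    (hp : ∀ a, polyFun a ∈ vanishingSet Z ↔ p ∣ a) : HasOrder Z (polyFun p) 1 :=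
  coe_polyEquiv p ▸ hasOrder_one_of_irreducible
    (hZ.irreducible_inclusion (center_eq_span_polyEquiv hZ hp))

theorem eq_of_polyFun_mem_vanishingSet [IsDiscreteValuationRing V.toSubring]
    (hV : IsLocalizationOf V (coordRing xFun yFun)) (hZ : IsLocalizationOf Z (coordRing xFun yFun))
    (hirr : Irreducible p) (hp : ∀ a, polyFun a ∈ vanishingSet Z ↔ p ∣ a)
    (hpV : polyFun p ∈ vanishingSet V) : Z = V := by
  have hprime : Prime (polyEquiv p) := (MulEquiv.prime_iff polyEquiv).2 hirr.prime
  exact hZ.eq_of_center_eq hV ((center_eq_span_polyEquiv hZ hp).trans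
    (hV.center_eq_span hprime ((polyEquiv_mem_center_iff hV).2 hpV)).symm)

end Curve

section Pushforward

variable {X Y : Model} {W : PrimeDivisor X} {Z : PrimeDivisor Y}

theorem pushforward_single_one : pushforward Y (Finsupp.single W 1) = pushforwardPrime Y W := by
  rw [pushforward, Finsupp.sum_single_index (by exact zero_smul ℤ _), one_smul]

theorem le_of_pushforwardPrime_eq_single (h : pushforwardPrime Y W = Finsupp.single Z 1) :
    Z.1 ≤ W.1 := by
  unfold pushforwardPrime at h
  split_ifs at h with hex
  · rw [← Finsupp.single_left_injective one_ne_zero h]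
    exact hex.choose_spec
  · exact absurd h.symm (Finsupp.single_ne_zero.2 one_ne_zero)

theorem pushforwardPrime_ne_zero (h : Z.1 ≤ W.1) : pushforwardPrime Y W ≠ 0 := by
  unfold pushforwardPrime
  rw [dif_pos ⟨Z, h⟩]
  exact Finsupp.single_ne_zero.2 one_ne_zero

end Pushforward

variable {X Y : Model} {V W : PrimeDivisor X}

theorem IsDefiningPolynomial.hasOrder {p : MvPolynomial (Fin 2) ℂ}
    (hp : IsDefiningPolynomial (pushforward P1P1 (Finsupp.single W 1)) p)
    (hV : IsLocalizationOf V.1 (coordRing xFun yFun)) :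
    HasOrder V.1 (polyFun p) ((Finsupp.single W 1 : WeilDiv X) V) := by
  have := V.2.2
  have hVP := mem_P1P1_of_isLocalizationOf hV
  have hasOrder_one_of_ne (hne : W ≠ V) :
      HasOrder V.1 (polyFun 1) ((Finsupp.single W 1 : WeilDiv X) V) := by
    rw [Finsupp.single_eq_of_ne' hne, polyFun, map_one]
    exact hasOrder_one
  rw [pushforward_single_one] at hp
  obtain ⟨h0, rfl⟩ | ⟨Z, hZ, h⟩ := hp
  · refine hasOrder_one_of_ne ?_
    rintro rfl
    exact pushforwardPrime_ne_zero (Z := ⟨W.1, hVP, W.2.2⟩) le_rfl h0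
  have := Z.2.2
  have := (isRegularModel_P1P1.isRegularPoint Z.1 Z.2.1).isFractionRing
  have hZW : Z.1 = W.1 :=
    eq_of_le_of_isDiscreteValuationRing (le_of_pushforwardPrime_eq_single hZ)
  obtain ⟨⟨hx, hy⟩, hirr, hpZ⟩ | ⟨hxy, rfl⟩ := h
  · have hloc := isProductCoordinates_xFun_yFun.isLocalizationOf Z.2.1 hx hy
    by_cases hWV : W = V
    · rw [← hWV, Finsupp.single_eq_same, ← hZW]
      exact hasOrder_polyFun_one hloc hpZ
    · have hpV : polyFun p ∈ V.1.toSubring := coe_polyEquiv p ▸ hV.le (polyEquiv p).2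
      rw [Finsupp.single_eq_of_ne' hWV, hasOrder_zero_iff_notMem_vanishingSet hpV]
      exact fun hmem => hWV (Subtype.ext
        (hZW.symm.trans (eq_of_polyFun_mem_vanishingSet hV hloc hirr hpZ hmem)))
  · refine hasOrder_one_of_ne ?_
    rintro rfl
    rw [hZW] at hxy
    exact hxy ⟨hV.le (fst_mem_coordRing _ _), hV.le (snd_mem_coordRing _ _)⟩

theorem hasOrder_finsuppProd {ι : Type*} {D : ι →₀ ℤ} {f : ι → RatFun} {E : ι → WeilDiv X}
    (h : ∀ i ∈ D.support, HasOrder V.1 (f i) (E i V)) :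
    HasOrder V.1 (D.prod fun i n => f i ^ n) ((D.sum fun i n => n • E i) V) := by
  have := V.2.2
  rw [Finsupp.sum, Finsupp.finsetSum_apply]
  exact HasOrder.prod _ fun i hi => (h i hi).zpow (D i)

theorem hasOrder_factorProduct {A : WeilDiv Y} {B : PrimeDivisor Y → WeilDiv X}
    {p : PrimeDivisor Y → PrimeDivisor X → MvPolynomial (Fin 2) ℂ}
    (hp : ∀ Z ∈ A.support, ∀ W ∈ (B Z).support,
      IsDefiningPolynomial (pushforward P1P1 (Finsupp.single W 1)) (p Z W))
    (hV : IsLocalizationOf V.1 (coordRing xFun yFun)) :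
    HasOrder V.1 (factorProduct A B p) ((A.sum fun Z n => n • B Z) V) := by
  refine hasOrder_finsuppProd fun Z hZ => ?_
  have hBZ := hasOrder_finsuppProd fun W hW => (hp Z hZ W hW).hasOrder hV
  simp only [Finsupp.smul_single, smul_eq_mul, mul_one] at hBZ
  rwa [Finsupp.sum_single] at hBZ

/-! ### Functions without zeros and poles in the affine plane -/

theorem exists_isLocalizationOf_isDiscreteValuationRing :
    ∃ V, IsLocalizationOf V (coordRing xFun yFun) ∧ IsDiscreteValuationRing V.toSubring := by
  have hxy := isProductCoordinates_xFun_yFun.isCoordPair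
  have := hxy.isNoetherianRing
  have hline := hxy.prime_line 0
  have : (Ideal.span {line xFun yFun 0}).IsPrime :=
    (Ideal.span_singleton_prime hline.ne_zero).2 hline
  have hloc := isLocalizationOf_ofPrime _ (Ideal.span {line xFun yFun 0})
  exact ⟨_, hloc, hloc.isDiscreteValuationRing hline.ne_zero (center_ofPrime _ _)⟩

theorem exists_eq_algebraMap_of_hasOrder_zero {f : RatFun}
    (h : ∀ V, IsLocalizationOf V (coordRing xFun yFun) → IsDiscreteValuationRing V.toSubring →
      HasOrder V f 0) : ∃ c : ℂ, c ≠ 0 ∧ f = algebraMap ℂ RatFun c := by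
  have hxy := isProductCoordinates_xFun_yFun.isCoordPair
  have := hxy.isNoetherianRing
  have := hxy.uniqueFactorizationMonoid
  have := hxy.isFractionRing
  have hf0 : f ≠ 0 := by
    obtain ⟨V, hV, hdvr⟩ := exists_isLocalizationOf_isDiscreteValuationRing
    exact (h V hV hdvr).ne_zero
  have hf : f ∈ coordRing xFun yFun :=
    mem_of_forall_isDiscreteValuationRing fun V hV hdvr => (hasOrder_zero_iff.1 (h V hV hdvr)).2.1
  have hinv : f⁻¹ ∈ coordRing xFun yFun :=
    mem_of_forall_isDiscreteValuationRing fun V hV hdvr => (hasOrder_zero_iff.1 (h V hV hdvr)).2.2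
  have hunit : IsUnit (⟨f, hf⟩ : coordRing xFun yFun) :=
    isUnit_iff_ne_zero_and_inv_mem.2 ⟨hf0, hinv⟩
  obtain ⟨p, hp⟩ := polyEquiv.surjective ⟨f, hf⟩
  rw [← hp, MulEquiv.isUnit_map, MvPolynomial.isUnit_iff_eq_C_of_isReduced] at hunit
  obtain ⟨c, hc, rfl⟩ := hunit
  refine ⟨c, hc.ne_zero, ?_⟩
  calc f = polyEquiv (MvPolynomial.C c) := (congrArg Subtype.val hp).symm
    _ = polyFun (MvPolynomial.C c) := coe_polyEquiv _
    _ = algebraMap ℂ RatFun c := rfl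

/-! ### Pulling back a coordinate -/

theorem map_linForm (φ : RatFun →ₐ[ℂ] RatFun) (a : OnePoint ℂ) (c : RatFun) :
    φ (linForm a c) = linForm a (φ c) := by
  induction a using OnePoint.rec with
  | infty => exact map_one φ
  | coe b => rw [linForm_coe, linForm_coe, map_sub, AlgHom.commutes]

theorem IsProductCoordinates.exists_linForm_div_eq {X Y : Model} (hX : IsBlownUpSurface X)
    (hY : IsBlownUpSurface Y) (φ : RatFun →ₐ[ℂ] RatFun) {c d : RatFun}
    (h : IsProductCoordinates c d) {a₁ a₂ : OnePoint ℂ} {D₁ D₂ : WeilDiv P1P1}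
    (hD₁ : IsCoordinateLine c a₁ D₁) (hD₂ : IsCoordinateLine c a₂ D₂) {A₁ A₂ : WeilDiv Y}
    (hA₁ : IsPullback (AlgHom.id ℂ RatFun) D₁ A₁) (hA₂ : IsPullback (AlgHom.id ℂ RatFun) D₂ A₂)
    {B : PrimeDivisor Y → WeilDiv X}
    (hB₁ : ∀ Z ∈ A₁.support, IsPullback φ (Finsupp.single Z 1) (B Z))
    (hB₂ : ∀ Z ∈ A₂.support, IsPullback φ (Finsupp.single Z 1) (B Z))
    {p₁ p₂ : PrimeDivisor Y → PrimeDivisor X → MvPolynomial (Fin 2) ℂ}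
    (hp₁ : ∀ Z ∈ A₁.support, ∀ W ∈ (B Z).support,
      IsDefiningPolynomial (pushforward P1P1 (Finsupp.single W 1)) (p₁ Z W))
    (hp₂ : ∀ Z ∈ A₂.support, ∀ W ∈ (B Z).support,
      IsDefiningPolynomial (pushforward P1P1 (Finsupp.single W 1)) (p₂ Z W)) :
    ∃ C : ℂ, C ≠ 0 ∧ linForm a₁ (φ c) / linForm a₂ (φ c) =
      algebraMap ℂ RatFun C * (factorProduct A₁ B p₁ / factorProduct A₂ B p₂) := by
  obtain ⟨W₁, hW₁, rfl⟩ := hD₁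
  obtain ⟨W₂, hW₂, rfl⟩ := hD₂
  have hYreg := hY.isRegularModel
  have divisor_on_Y : IsDivisorOf (A₁ - A₂) (linForm a₁ c / linForm a₂ c) :=
    (h.isDivisorOf_linForm_div hW₁ hW₂).map isRegularModel_P1P1 (hA₁.sub isRegularModel_P1P1 hA₂)
  have pullback₁ := IsPullback.of_forall_mem_support (hA₁.ne_zero_of_single hY) hYreg hB₁
  have pullback₂ := IsPullback.of_forall_mem_support (hA₂.ne_zero_of_single hY) hYreg hB₂
  have divisor_on_X := divisor_on_Y.map hYreg (pullback₁.sub hYreg pullback₂)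
  rw [map_div₀, map_linForm, map_linForm] at divisor_on_X
  obtain ⟨C, hC, hquot⟩ := exists_eq_algebraMap_of_hasOrder_zero fun V hV hdvr => by
    let V' : PrimeDivisor X := ⟨V, hX.mem_of_mem_P1P1 (mem_P1P1_of_isLocalizationOf hV), hdvr⟩
    have hfactor := (hasOrder_factorProduct (V := V') hp₁ hV).div (hasOrder_factorProduct hp₂ hV)
    simpa only [Finsupp.sub_apply, sub_self] using (divisor_on_X.2 V').div hfactor
  have hquot_ne_zero := (map_ne_zero (algebraMap ℂ RatFun)).2 hC
  rw [← hquot] at hquot_ne_zero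
  exact ⟨C, hC, (div_eq_iff (div_ne_zero_iff.1 hquot_ne_zero).2).1 hquot⟩

end BlowupFactorization

end

theorem mainTheorem2
    -- the blown-up surfaces and the comorphism of the dominant rational map and of its lift
    (X Xbar : Model) (hX : IsBlownUpSurface X) (hXbar : IsBlownUpSurface Xbar)
    (φ : RatFun →ₐ[ℂ] RatFun)
    (x₁ x₂ y₁ y₂ : OnePoint ℂ) (hx : x₁ ≠ x₂) (hy : y₁ ≠ y₂)
    -- the four coordinate lines on the target
    (D : Fin 4 → WeilDiv P1P1)
    (hD₁ : IsCoordinateLine xFun x₁ (D 0)) (hD₂ : IsCoordinateLine xFun x₂ (D 1))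
    (hD₃ : IsCoordinateLine yFun y₁ (D 2)) (hD₄ : IsCoordinateLine yFun y₂ (D 3))
    -- their pull-backs to the blown-up target surface
    (A : Fin 4 → WeilDiv Xbar) (hA : ∀ i, IsPullback (AlgHom.id ℂ RatFun) (D i) (A i))
    -- the pull-backs of the components under the lifted map
    (B : PrimeDivisor Xbar → WeilDiv X)
    (hB : ∀ i, ∀ Z ∈ (A i).support, IsPullback φ (Finsupp.single Z 1) (B Z))
    -- irreducible defining polynomials of the push-forwards of their components
    (p : Fin 4 → PrimeDivisor Xbar → PrimeDivisor X → MvPolynomial (Fin 2) ℂ)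
    (hp : ∀ i, ∀ Z ∈ (A i).support, ∀ W ∈ (B Z).support,
      IsDefiningPolynomial (pushforward P1P1 (Finsupp.single W 1)) (p i Z W)) :
    (∃ C₁ : ℂ, C₁ ≠ 0 ∧
      linForm x₁ (φ xFun) / linForm x₂ (φ xFun) =
        algebraMap ℂ RatFun C₁ * (factorProduct (A 0) B (p 0) / factorProduct (A 1) B (p 1))) ∧
    (∃ C₂ : ℂ, C₂ ≠ 0 ∧
      linForm y₁ (φ yFun) / linForm y₂ (φ yFun) =
        algebraMap ℂ RatFun C₂ * (factorProduct (A 2) B (p 2) / factorProduct (A 3) B (p 3))) := by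
  have hxy := isProductCoordinates_xFun_yFun
  exact ⟨hxy.exists_linForm_div_eq hX hXbar φ hD₁ hD₂ (hA 0) (hA 1) (hB 0) (hB 1) (hp 0) (hp 1),
    hxy.swap.exists_linForm_div_eq hX hXbar φ hD₃ hD₄ (hA 2) (hA 3) (hB 2) (hB 3) (hp 2) (hp 3)⟩
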